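/- **Definitions.** A *forest algebra* $(H,V)$ is a monoid $(H,+,0)$ and a monoid $(V,\cdot,1)$ with a faithful left action of $V$ on the set $H$ such that for each $h\in H$ there are elements $1+h,\ h+1\in V$ with $(1+h)g=g+h$ and $(h+1)g=h+g$ for all $g\in H$. Homomorphisms are pairs of monoid homomorphisms compatible with the actions. $(H_1,V_1)$ *divides* $(H_2,V_2)$ if it is a quotient (surjective homomorphic image) of a subalgebra of $(H_2,V_2)$, where a subalgebra is given by submonoids $K\subseteq H_2$ and $W\subseteq V_2$ with $WK\subseteq K$ such that $W$ contains elements that act on $K$ as the translations by the elements of $K$ (elements of $W$ that act identically on $K$ being identified). The *wreath product* $(H_1,V_1)\circ(H_2,V_2)$ has horizontal monoid $H_1\times H_2$ with componentwise addition, and vertical monoid $V_1\times V_2^{H_1}$ acting by $(v,f)(h_1,h_2)=(vh_1,f(h_1)h_2)$. $\mathcal U_2$ is the forest algebra $(\{0,\infty\},\{1,c_0,c_\infty\})$, where $\infty$ is absorbing for $+$ and $c_h h'=h$ for all $h,h'$. A finite monoid $S$ is *aperiodic* if $s^m=s^{m+1}$ for some $m>0$ and all $s\in S$. A *path algebra*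 is a finite forest algebra $(H,V)$ with $H$ aperiodic and commutative such that $vg+vh=v(g+h)+v0$ and $u(g+h)=u(g+uh)$ for all $g,h\in H$ and $u,v\in V$ with $u^2=u$; it is an *aperiodic path algebra* if moreover $V$ is aperiodic. *CTL-algebras*, *FO-algebras* and *graded PDL-algebras* are the divisors of iterated wreath products of copies of $\mathcal U_2$, of aperiodic path algebras, and of path algebras, respectively. Let $A$ be a finite alphabet. $A^\Delta=(H_A,V_A)$ is the free forest algebra of finite ordered forests over $A$ and contexts over $A$ (forests with one hole $\Box$ at a leaf). A *multicontext* $p$ over $A$ is a forest over $A$ some of whose leaves have been replaced by holes $\Box$; it is *uniform* if every leaf is a hole and all subtrees at the same level are identical. Let $\alpha:A^\Delta\to(H,V)$ be a homomorphism. For a valuation $\mu:\mathrm{holes}(p)\to H$, the value $p[\mu]\in H$ is obtained by evaluating each hole $x$ as $\mu(x)$ and each node labelled $a$ as the action of $\alpha(a\Box)$. Write $p[g]$ for $p[\mu]$ when $\mu$ is constantly $g$; for $G\subseteq H$, $g\in G$ and $x\in\mathrm{holes}(p)$ let $p[g/x][G]$ be the set of all $p[\mu]$ with $\mu(x)=g$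 and $\mu(y)\in G$ for $y\ne x$. $(H,V)$ has *vertical confusion* with respect to $p$ (for $\alpha$) if there are $k>1$ and pairwise distinct $g_0,\dots,g_{k-1}\in H$ with $p[g_i]=g_{(i+1)\bmod k}$ for all $i$. It has *horizontal confusion* with respect to $p$ (for $\alpha$) if there is a set $G\subseteq H$ with $|G|>1$ such that $G\subseteq p[g/x][G]$ for every $g\in G$ and every hole $x$ of $p$. **Theorem (Confusion Theorem).** Let $(H,V)$ be a forest algebra. - If $(H,V)$ is a CTL-algebra, then it does not have vertical confusion with respect to any multicontext. - If $(H,V)$ is an FO-algebra, then it does not have vertical confusion with respect to any uniform multicontext. - If $(H,V)$ is a graded PDL-algebra, then it does not have horizontal confusion with respect to any multicontext that has at least one hole. Here each statement is for every finite alphabet $A$, every multicontext of the given kind over $A$, and every homomorphism $\alpha:A^\Delta\to(H,V)$. -/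

import Mathlib

universe u v

/-- A forest algebra `(H, V)`: two monoids, the horizontal one written additively and the vertical
one multiplicatively, with a faithful left action of `V` on `H` such that all translations
`g ↦ g + h` and `g ↦ h + g` of `H` are induced by elements of `V`. Neither monoid is assumed to be
commutative, and the action is not assumed to be additive. -/
structure ForestAlgebra where
  H : Type u
  V : Type u
  [addMonoidH : AddMonoid H]
  [monoidV : Monoid V]
  [mulAction : MulAction V H]
  [faithful : FaithfulSMul V H]
  exists_smul_eq_add_right : ∀ h : H, ∃ x : V, ∀ g : H, x • g = g + h
  exists_smul_eq_add_left : ∀ h : H, ∃ x : V, ∀ g : H, x • g = h + g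

attribute [instance] ForestAlgebra.addMonoidH ForestAlgebra.monoidV ForestAlgebra.mulAction
  ForestAlgebra.faithful

namespace ForestAlgebra

/-- Homomorphisms of forest algebras: pairs of monoid homomorphisms compatible with the actions. -/
structure Hom (X : ForestAlgebra.{u}) (Y : ForestAlgebra.{v}) where
  onH : X.H →+ Y.H
  onV : X.V →* Y.V
  map_smul : ∀ (x : X.V) (h : X.H), onH (x • h) = onV x • onH h

/-- `X` divides `Y`: `X` is a quotient of a subalgebra of `Y`. The subalgebra is given by
submonoids `K` of `Y.H` and `W` of `Y.V` such that `W` preserves `K` and contains elements that act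
on `K` as the translations by elements of `K`, and the quotient map by a surjective homomorphism
from `(K, W)` to `X`. Since `X` is faithful, this homomorphism factors through the reduction of
`W` to the monoid of transformations of `K` that it induces, so it does not matter whether
that reduction is made first. -/
def Divides (X : ForestAlgebra.{u}) (Y : ForestAlgebra.{v}) : Prop :=
  ∃ (K : AddSubmonoid Y.H) (W : Submonoid Y.V)
    (stable : ∀ x ∈ W, ∀ h ∈ K, x • h ∈ K)
    (φ : K →+ X.H) (ψ : W →* X.V),
    (∀ h ∈ K, ∃ x ∈ W, ∀ g ∈ K, x • g = g + h) ∧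
    (∀ h ∈ K, ∃ x ∈ W, ∀ g ∈ K, x • g = h + g) ∧
    Function.Surjective φ ∧ Function.Surjective ψ ∧
    ∀ (x : W) (h : K), φ ⟨(x : Y.V) • (h : Y.H), stable x x.2 h h.2⟩ = ψ x • φ h

/-! ### The wreath product -/

/-- The vertical monoid `V₁ × V₂^{H₁}` of the wreath product. -/
@[ext]
structure WreathV (X Y : ForestAlgebra.{u}) where
  fst : X.V
  snd : X.H → Y.V

instance (X Y : ForestAlgebra.{u}) : Monoid (WreathV X Y) where
  mul x y := ⟨x.fst * y.fst, fun h => x.snd (y.fst • h) * y.snd h⟩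
  one := ⟨1, fun _ => 1⟩
  mul_assoc x y z := by
    refine WreathV.ext (mul_assoc x.fst y.fst z.fst) (funext fun h => ?_)
    change x.snd (y.fst • z.fst • h) * y.snd (z.fst • h) * z.snd h =
      x.snd ((y.fst * z.fst) • h) * (y.snd (z.fst • h) * z.snd h)
    rw [mul_smul, mul_assoc]
  one_mul x := WreathV.ext (one_mul x.fst) (funext fun h => one_mul (x.snd h))
  mul_one x := by
    refine WreathV.ext (mul_one x.fst) (funext fun h => ?_)
    change x.snd ((1 : X.V) • h) * 1 = x.snd h
    rw [one_smul, mul_one]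

/-- The action of `V₁ × V₂^{H₁}` on `H₁ × H₂`. -/
instance (X Y : ForestAlgebra.{u}) : MulAction (WreathV X Y) (X.H × Y.H) where
  smul x h := (x.fst • h.1, x.snd h.1 • h.2)
  one_smul h := Prod.ext (one_smul X.V h.1) (one_smul Y.V h.2)
  mul_smul x y h := Prod.ext (mul_smul x.fst y.fst h.1)
    (mul_smul (x.snd (y.fst • h.1)) (y.snd h.1) h.2)

instance (X Y : ForestAlgebra.{u}) : FaithfulSMul (WreathV X Y) (X.H × Y.H) where
  eq_of_smul_eq_smul {x y} hxy := by
    refine WreathV.ext ?_ (funext fun h => ?_)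
    · exact FaithfulSMul.eq_of_smul_eq_smul fun h : X.H => congrArg Prod.fst (hxy (h, 0))
    · exact FaithfulSMul.eq_of_smul_eq_smul fun g : Y.H => congrArg Prod.snd (hxy (h, g))

/-- The wreath product `X ∘ Y`, with componentwise addition on `H₁ × H₂`. -/
def wreath (X Y : ForestAlgebra.{u}) : ForestAlgebra.{u} where
  H := X.H × Y.H
  V := WreathV X Y
  exists_smul_eq_add_right h := by
    obtain ⟨x, hx⟩ := X.exists_smul_eq_add_right h.1
    obtain ⟨y, hy⟩ := Y.exists_smul_eq_add_right h.2
    exact ⟨⟨x, fun _ => y⟩, fun g => Prod.ext (hx g.1) (hy g.2)⟩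
  exists_smul_eq_add_left h := by
    obtain ⟨x, hx⟩ := X.exists_smul_eq_add_left h.1
    obtain ⟨y, hy⟩ := Y.exists_smul_eq_add_left h.2
    exact ⟨⟨x, fun _ => y⟩, fun g => Prod.ext (hx g.1) (hy g.2)⟩

/-- The iterated wreath products of algebras in the class `C`: all wreath products of one or more
members of `C`, with any bracketing. -/
inductive IsIteratedWreath (C : ForestAlgebra.{u} → Prop) : ForestAlgebra.{u} → Prop
  | base {X : ForestAlgebra.{u}} : C X → IsIteratedWreath C X
  | wreath {X Y : ForestAlgebra.{u}} :
      IsIteratedWreath C X → IsIteratedWreath C Y → IsIteratedWreath C (X.wreath Y)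

/-! ### The algebraic bases -/

/-- The horizontal monoid `{0, ∞}` of `𝒰₂`. -/
inductive U₂H : Type
  | zero
  | infty

/-- The vertical monoid `{1, c₀, c_∞}` of `𝒰₂`. -/
inductive U₂V : Type
  | one
  | const (h : U₂H)

instance : Zero U₂H := ⟨.zero⟩

/-- `0` is neutral and `∞` is absorbing. -/
instance : Add U₂H where
  add
    | .zero, h => h
    | .infty, _ => .infty

instance : AddMonoid U₂H where
  nsmul := nsmulRec
  add_assoc := by rintro (_ | _) (_ | _) (_ | _) <;> rfl
  zero_add := by rintro (_ | _) <;> rfl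
  add_zero := by rintro (_ | _) <;> rfl

instance : Monoid U₂V where
  one := .one
  mul
    | .one, x => x
    | .const h, _ => .const h
  mul_assoc := by rintro (_ | _) (_ | _) (_ | _) <;> rfl
  one_mul := by rintro (_ | _) <;> rfl
  mul_one := by rintro (_ | _) <;> rfl

instance : MulAction U₂V U₂H where
  smul
    | .one, g => g
    | .const h, _ => h
  one_smul _ := rfl
  mul_smul := by rintro (_ | _) (_ | _) _ <;> rfl

instance : FaithfulSMul U₂V U₂H where
  eq_of_smul_eq_smul := by
    rintro (_ | h) (_ | h') hxy
    · rfl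
    · have h₁ : U₂H.zero = h' := hxy .zero
      have h₂ : U₂H.infty = h' := hxy .infty
      exact absurd (h₁.trans h₂.symm) (by simp)
    · have h₁ : h = U₂H.zero := hxy .zero
      have h₂ : h = U₂H.infty := hxy .infty
      exact absurd (h₁.symm.trans h₂) (by simp)
    · exact congrArg U₂V.const (hxy .zero)

/-- The forest algebra `𝒰₂ = ({0, ∞}, {1, c₀, c_∞})` with `c_h • h' = h`. -/
def U₂ : ForestAlgebra.{0} where
  H := U₂H
  V := U₂V
  exists_smul_eq_add_right := by
    rintro (_ | _)
    · exact ⟨.one, by rintro (_ | _) <;> rfl⟩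
    · exact ⟨.const .infty, by rintro (_ | _) <;> rfl⟩
  exists_smul_eq_add_left := by
    rintro (_ | _)
    · exact ⟨.one, by rintro (_ | _) <;> rfl⟩
    · exact ⟨.const .infty, by rintro (_ | _) <;> rfl⟩

/-- A path algebra: a finite forest algebra whose horizontal monoid is aperiodic and commutative
and which satisfies the two path identities. -/
structure IsPathAlgebra (X : ForestAlgebra.{u}) : Prop where
  finite_H : Finite X.H
  finite_V : Finite X.V
  add_comm : ∀ g h : X.H, g + h = h + g
  aperiodic_H : ∃ m : ℕ, 0 < m ∧ ∀ h : X.H, m • h = (m + 1) • h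
  smul_add_smul : ∀ (x : X.V) (g h : X.H), x • g + x • h = x • (g + h) + x • (0 : X.H)
  idem_smul_add : ∀ (x : X.V), x * x = x → ∀ g h : X.H, x • (g + h) = x • (g + x • h)

/-- An aperiodic path algebra: a path algebra whose vertical monoid is aperiodic. -/
structure IsAperiodicPathAlgebra (X : ForestAlgebra.{u}) : Prop extends IsPathAlgebra X where
  aperiodic_V : ∃ m : ℕ, 0 < m ∧ ∀ x : X.V, x ^ m = x ^ (m + 1)

/-- CTL-algebras: the divisors of iterated wreath products of copies of `𝒰₂`. -/
def IsCTLAlgebra (X : ForestAlgebra.{u}) : Prop :=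
  ∃ Y : ForestAlgebra.{0}, IsIteratedWreath (fun Z => Z = U₂) Y ∧ X.Divides Y

/-- FO-algebras: the divisors of iterated wreath products of aperiodic path algebras. -/
def IsFOAlgebra (X : ForestAlgebra.{u}) : Prop :=
  ∃ Y : ForestAlgebra.{u}, IsIteratedWreath IsAperiodicPathAlgebra Y ∧ X.Divides Y

/-- Graded PDL-algebras: the divisors of iterated wreath products of path algebras. -/
def IsGradedPDLAlgebra (X : ForestAlgebra.{u}) : Prop :=
  ∃ Y : ForestAlgebra.{u}, IsIteratedWreath IsPathAlgebra Y ∧ X.Divides Y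

end ForestAlgebra

/-! ### Forests, contexts and the free forest algebra -/

/-- Forests over `A`, that is, finite sequences of trees: `nil` is the empty forest, and
`cons a s t` is the forest `a s + t`, whose first tree has root label `a` and subforest `s`. -/
inductive Forest (A : Type v) : Type v
  | nil
  | cons (a : A) (s t : Forest A)

namespace Forest

variable {A : Type v}

/-- Concatenation of forests. -/
def append : Forest A → Forest A → Forest A
  | nil, t => t
  | cons a s t, t' => cons a s (append t t')

instance : Zero (Forest A) := ⟨nil⟩

instance : Add (Forest A) := ⟨append⟩

instance : AddMonoid (Forest A) where
  nsmul := nsmulRec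
  add_assoc x y z := by
    change append (append x y) z = append x (append y z)
    induction x with
    | nil => rfl
    | cons a s t _ ih => simp only [append, ih]
  zero_add _ := rfl
  add_zero x := by
    change append x nil = x
    induction x with
    | nil => rfl
    | cons a s t _ ih => simp only [append, ih]

/-- The tree `a s`, as a forest. -/
def tree (a : A) (s : Forest A) : Forest A := cons a s nil

end Forest

/-- Contexts over `A`, that is, forests with exactly one hole, at a leaf: `hole s t` is the context
`s + □ + t`, and `node s a p t` is the context `s + a p + t`. -/
inductive Context (A : Type v) : Type v
  | hole (s t : Forest A)
  | node (s : Forest A) (a : A) (p : Context A) (t : Forest A)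

namespace Context

variable {A : Type v}

/-- The context `a □`. -/
def letter (a : A) : Context A := node 0 a (hole 0 0) 0

/-- The forest `p s` obtained by substituting the forest `s` for the hole of `p`. -/
def apply : Context A → Forest A → Forest A
  | hole l r, s => l + s + r
  | node l a p r, s => l + Forest.tree a (apply p s) + r

/-- The context `l + p + r`. -/
def pad (l : Forest A) : Context A → Forest A → Context A
  | hole l' r', r => hole (l + l') (r' + r)
  | node l' a p r', r => node (l + l') a p (r' + r)

/-- The context `p q` obtained by substituting the context `q` for the hole of `p`. -/
def comp : Context A → Context A → Context A
  | hole l r, q => pad l q r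
  | node l a p r, q => node l a (comp p q) r

theorem apply_pad (l r : Forest A) (p : Context A) (s : Forest A) :
    (pad l p r).apply s = l + p.apply s + r := by
  cases p <;> simp only [pad, apply, add_assoc]

theorem apply_comp (p q : Context A) (s : Forest A) :
    (p.comp q).apply s = p.apply (q.apply s) := by
  induction p with
  | hole l r => exact apply_pad l r q s
  | node l a p r ih => simp only [comp, apply, ih]

theorem comp_pad (l r : Forest A) (p q : Context A) :
    (pad l p r).comp q = pad l (p.comp q) r := by
  cases p with
  | hole l' r' => cases q <;> simp only [pad, comp, add_assoc]
  | node l' a p r' => rfl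

instance : Monoid (Context A) where
  mul := comp
  one := hole 0 0
  mul_assoc p q r := by
    change comp (comp p q) r = comp p (comp q r)
    induction p with
    | hole s t => exact comp_pad s t q r
    | node s a p t ih => simp only [comp, ih]
  one_mul p := by
    change pad 0 p 0 = p
    cases p <;> simp only [pad, zero_add, add_zero]
  mul_one p := by
    change comp p (hole 0 0) = p
    induction p with
    | hole s t => simp only [comp, pad, zero_add, add_zero]
    | node s a p t ih => simp only [comp, ih]

instance : MulAction (Context A) (Forest A) where
  smul := apply
  one_smul s := by
    change (0 + s + 0 : Forest A) = s
    rw [zero_add, add_zero]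
  mul_smul := apply_comp

end Context

/-! The action of contexts on forests is faithful: a context can be recovered from its value at a
forest that is deeper than the context. -/

/-- The height of a forest. -/
def Forest.height {A : Type v} : Forest A → ℕ
  | nil => 0
  | cons _ s t => max (s.height + 1) t.height

theorem Forest.height_append {A : Type v} (s t : Forest A) :
    (s + t).height = max s.height t.height := by
  change (append s t).height = _
  induction s with
  | nil => simp [append, height]
  | cons a s t' _ ih => simp [append, height, ih, max_assoc]

/-- A tree of height `n + 1`. -/
def Forest.chain {A : Type v} (a : A) : ℕ → Forest A
  | 0 => nil
  | n + 1 => tree a (chain a n)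

theorem Forest.height_chain {A : Type v} (a : A) (n : ℕ) : (chain a n).height = n := by
  induction n with
  | zero => rfl
  | succ n ih => simp [chain, tree, height, ih]

/-- In a decomposition `l + a s + r` with `l` not as high as the tree `a s`, everything is
determined by the sum. -/
theorem Forest.decomp_inj {A : Type v} {n : ℕ} {a a' : A} {s s' r r' : Forest A}
    (hs : n ≤ s.height) (hs' : n ≤ s'.height) :
    ∀ {l l' : Forest A}, l.height ≤ n → l'.height ≤ n →
      l + tree a s + r = l' + tree a' s' + r' → l = l' ∧ a = a' ∧ s = s' ∧ r = r'
  | nil, nil, _, _, h => by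
    have h' : cons a s r = cons a' s' r' := h
    injection h' with h₁ h₂ h₃
    exact ⟨rfl, h₁, h₂, h₃⟩
  | nil, cons b t u, _, hl', h => by
    have h' : cons a s r = cons b t (u + tree a' s' + r') := h
    injection h' with h₁ h₂ h₃
    simp only [height] at hl'
    subst h₂
    omega
  | cons b t u, nil, hl, _, h => by
    have h' : cons b t (u + tree a s + r) = cons a' s' r' := h
    injection h' with h₁ h₂ h₃
    simp only [height] at hl
    subst h₂
    omega
  | cons b t u, cons b' t' u', hl, hl', h => by
    have h' : cons b t (u + tree a s + r) = cons b' t' (u' + tree a' s' + r') := h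
    injection h' with h₁ h₂ h₃
    simp only [height] at hl hl'
    obtain ⟨e₁, e₂⟩ := decomp_inj hs hs' (l := u) (l' := u') (by omega) (by omega) h₃
    exact ⟨by rw [h₁, h₂, e₁], e₂⟩

/-- A bound on the heights of the forests to the left and to the right of the path to the hole. -/
def Context.bound {A : Type v} : Context A → ℕ
  | hole s _ => s.height
  | node s _ p _ => max s.height p.bound

theorem Context.le_height_apply {A : Type v} (p : Context A) (s : Forest A) :
    s.height ≤ (p.apply s).height := by
  induction p with
  | hole l r => simp [apply, Forest.height_append]
  | node l a p r ih =>
    simp only [apply, Forest.height_append, Forest.tree, Forest.height]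
    omega

theorem Context.eq_of_apply_chain {A : Type v} {a : A} {n : ℕ} :
    ∀ {p q : Context A}, p.bound ≤ n → q.bound ≤ n →
      p.apply (Forest.chain a (n + 1)) = q.apply (Forest.chain a (n + 1)) → p = q
  | hole l r, hole l' r', hp, hq, h => by
    obtain ⟨h₁, -, -, h₂⟩ := Forest.decomp_inj (n := n) (Forest.height_chain a n).ge
      (Forest.height_chain a n).ge hp hq h
    rw [h₁, h₂]
  | hole l r, node l' b q r', hp, hq, h => by
    have hh := q.le_height_apply (Forest.chain a (n + 1))
    have hc := Forest.height_chain a n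
    simp only [bound] at hq
    rw [Forest.height_chain] at hh
    obtain ⟨-, -, h₁, -⟩ := Forest.decomp_inj (n := n) hc.ge (by omega) hp (by omega) h
    rw [h₁] at hc
    omega
  | node l b p r, hole l' r', hp, hq, h => by
    have hh := p.le_height_apply (Forest.chain a (n + 1))
    have hc := Forest.height_chain a n
    simp only [bound] at hp
    rw [Forest.height_chain] at hh
    obtain ⟨-, -, h₁, -⟩ := Forest.decomp_inj (n := n) (by omega) hc.ge (by omega) hq h
    rw [← h₁] at hc
    omega
  | node l b p r, node l' b' q r', hp, hq, h => by
    have hh := p.le_height_apply (Forest.chain a (n + 1))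
    have hh' := q.le_height_apply (Forest.chain a (n + 1))
    rw [Forest.height_chain] at hh hh'
    simp only [bound] at hp hq
    obtain ⟨h₁, h₂, h₃, h₄⟩ := Forest.decomp_inj (n := n) (by omega) (by omega)
      (by omega) (by omega) h
    rw [h₁, h₂, h₄, eq_of_apply_chain (by omega) (by omega) h₃]

instance (A : Type v) : FaithfulSMul (Context A) (Forest A) where
  eq_of_smul_eq_smul {p q} hpq := by
    rcases isEmpty_or_nonempty A with hA | ⟨⟨a⟩⟩
    · have hF : ∀ s : Forest A, s = .nil := by
        rintro (_ | ⟨a, _, _⟩)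
        · rfl
        · exact hA.elim a
      rcases p with ⟨s, t⟩ | ⟨_, a, _, _⟩
      · rcases q with ⟨s', t'⟩ | ⟨_, a, _, _⟩
        · rw [hF s, hF t, hF s', hF t']
        · exact hA.elim a
      · exact hA.elim a
    · exact Context.eq_of_apply_chain (a := a) (le_max_left p.bound q.bound)
        (le_max_right p.bound q.bound) (hpq _)

/-- The free forest algebra `A^Δ` of forests and contexts over `A`. -/
def freeForestAlgebra (A : Type v) : ForestAlgebra.{v} where
  H := Forest A
  V := Context A
  exists_smul_eq_add_right h :=
    ⟨Context.hole 0 h, fun g => congrArg (· + h) (zero_add g)⟩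
  exists_smul_eq_add_left h :=
    ⟨Context.hole h 0, fun g => add_zero (h + g)⟩

/-! ### Multicontexts -/

/-- Multicontexts over `A`, that is, forests over `A` in which some of the leaves have been replaced
by holes: `nil` is the empty multicontext, `hole q` is `□ + q`, and `node a p q` is `a p + q`. -/
inductive Multicontext (A : Type v) : Type v
  | nil
  | hole (q : Multicontext A)
  | node (a : A) (p q : Multicontext A)

namespace Multicontext

variable {A : Type v}

/-- The type of holes (occurrences of `□`) of a multicontext. -/
def Holes : Multicontext A → Type
  | nil => Empty
  | hole q => Option q.Holes
  | node _ p q => p.Holes ⊕ q.Holes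

/-- The value `p[μ] ∈ H` of the multicontext `p` at a valuation `μ : holes(p) → H`, where `(H, V)`
is a forest algebra and `α : A^Δ → (H, V)` a homomorphism: the holes are evaluated by `μ`, and a node
labelled `a` acts by `α(a □)` on the value of what is below it. -/
def eval {X : ForestAlgebra.{u}} (α : (freeForestAlgebra A).Hom X) :
    (p : Multicontext A) → (p.Holes → X.H) → X.H
  | nil, _ => 0
  | hole q, μ => μ none + q.eval α fun x => μ (some x)
  | node a p q, μ =>
      α.onV (Context.letter a) • p.eval α (fun x => μ (Sum.inl x)) +
        q.eval α fun x => μ (Sum.inr x)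

/-- The list of the subtrees of a multicontext at level `n` (the roots being at level `0`). Each of
them is a multicontext with exactly one root: a hole `□` or a tree `a p`. -/
def subtreesAt : ℕ → Multicontext A → List (Multicontext A)
  | _, nil => []
  | 0, hole q => hole nil :: subtreesAt 0 q
  | n + 1, hole q => subtreesAt (n + 1) q
  | 0, node a p q => node a p nil :: subtreesAt 0 q
  | n + 1, node _ p q => subtreesAt n p ++ subtreesAt (n + 1) q

/-- A multicontext is uniform if every leaf is a hole (there is no leaf `a` with a label in `A`)
and all subtrees at the same level are identical. -/
def IsUniform (p : Multicontext A) : Prop :=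
  (∀ (n : ℕ) (a : A), node a nil nil ∉ p.subtreesAt n) ∧
  ∀ (n : ℕ), ∀ s ∈ p.subtreesAt n, ∀ t ∈ p.subtreesAt n, s = t

variable {X : ForestAlgebra.{u}}

/-- The set `p[g/x][G]` of the values of `p` at all valuations that take the value `g` at the hole
`x` and have their values at the other holes in `G`. -/
def fixedValues (α : (freeForestAlgebra A).Hom X) (p : Multicontext A) (g : X.H) (x : p.Holes)
    (G : Set X.H) : Set X.H :=
  {h | ∃ μ : p.Holes → X.H, μ x = g ∧ (∀ y, y ≠ x → μ y ∈ G) ∧ p.eval α μ = h}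

/-- `(H, V)` has horizontal confusion, by way of `α : A^Δ → (H, V)`, with respect to `p` and the
set `G`: `G` has at least two elements, and `G ⊆ p[g/x][G]` for all `g ∈ G` and all holes `x`. -/
def HorizontalConfusion (α : (freeForestAlgebra A).Hom X) (p : Multicontext A) (G : Set X.H) :
    Prop :=
  G.Nontrivial ∧ ∀ g ∈ G, ∀ x : p.Holes, G ⊆ p.fixedValues α g x G

/-- `(H, V)` has vertical confusion, by way of `α : A^Δ → (H, V)`, with respect to `p` and the set
`{g 0, …, g (k - 1)}` of `k` elements: `k > 1` and `p[g i] = g (i + 1 mod k)` for all `i`. -/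
def VerticalConfusion (α : (freeForestAlgebra A).Hom X) (p : Multicontext A) {k : ℕ}
    (g : Fin k → X.H) : Prop :=
  1 < k ∧ Function.Injective g ∧
    ∀ i j : Fin k, (j : ℕ) = ((i : ℕ) + 1) % k → p.eval α (fun _ => g i) = g j

end Multicontext

/-! Vertical confusion is a nontrivial cycle of the map `h ↦ p[h]`, so it suffices that all periodic
points of such maps are fixed. This property passes to skew products, and in a wreath product the
maps given by (uniform) multicontexts are skew products of maps of the same kind in the factors
(`PolyFun.wreath`, `UniformFun.wreath`). A cycle in a divisor of a finite algebra lifts, since the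
orbit of any preimage is eventually periodic (`no_cycle_of_lift`). Only the bases remain. In `𝒰₂`
the maps are monotone on a two-element chain. In an aperiodic path algebra a uniform multicontext
acts as `h ↦ x • n • h`, and aperiodicity of both monoids finishes the argument
(`IsAperiodicPathAlgebra.uniformFun_fixed`).

For horizontal confusion, multicontexts are generalized to polynomials with constants, which are
closed under composition and under plugging values into holes. The condition `G ⊆ p.vals G` in
`Confusion` takes over the role of having a hole. Confusion descends from a wreath product to a
factor: either the first components of `G` differ, or they all agree and the second ones differ
(`Confusion.of_wreath`). It lifts from a divisor by a minimality argument over compositions of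
polynomials (`exists_confusion_of_lift`).

In a path algebra, filling all holes but one gives a family of contexts along one path, and
confusion says that each such family moves every element of `G` to every other. Contexts on the same
path differ only by a constant summand, after linearization, so an idempotent `u` in such a family
makes all elements of `G` comparable in both directions in an order on its image; hence `u` is
constant on `G` (`IsConfusingFamily.smul_eq`). On the other hand, a `w` that separates points of `G`
can always be extended to some `w * x` that still does, with `x` in such a family. As `V` is finite,
this gives `w = w * x` for some such `w` and some `x` in a product of these families, and then `w =
w * u` for an idempotent power `u` of `x`, a contradiction. -/

/-! ### Maps all of whose periodic points are fixed -/

/-- Every periodic point of `f` is a fixed point. -/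
def PeriodicPointsFixed {H : Type*} (f : H → H) : Prop :=
  ∀ d : ℕ, 0 < d → ∀ h : H, f^[d] h = h → f h = h

/-- A skew product of maps whose periodic points are fixed is such a map. -/
theorem PeriodicPointsFixed.skewProduct {H₁ H₂ : Type*} {F : H₁ × H₂ → H₁ × H₂} {f : H₁ → H₁}
    {f' : H₁ → H₂ → H₂} (h₁ : ∀ h, (F h).1 = f h.1) (h₂ : ∀ x y, (F (x, y)).2 = f' x y)
    (hf : PeriodicPointsFixed f) (hf' : ∀ x, PeriodicPointsFixed (f' x)) :
    PeriodicPointsFixed F := by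
  rintro d hd ⟨x, y⟩ hxy
  have e₁ : ∀ n h, (F^[n] h).1 = f^[n] h.1 := by
    intro n
    induction n with
    | zero => intro h; rfl
    | succ n ih => intro h; rw [Function.iterate_succ_apply, ih, h₁, Function.iterate_succ_apply]
  have hx : f x = x := hf d hd x (by rw [← e₁ d (x, y), hxy])
  -- Since `x` is fixed, the fibre over it is invariant, and `F` acts there as `f' x`.
  have hF : ∀ z, F (x, z) = (x, f' x z) := fun z => Prod.ext ((h₁ _).trans hx) (h₂ x z)
  have e₂ : ∀ n z, F^[n] (x, z) = (x, (f' x)^[n] z) := by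
    intro n
    induction n with
    | zero => intro z; rfl
    | succ n ih => intro z; rw [Function.iterate_succ_apply, hF, ih, Function.iterate_succ_apply]
  rw [hF, hf' x d hd y (congrArg Prod.snd ((e₂ d y).symm.trans hxy))]

/-- On a finite set, a map that lifts a map with a nontrivial cycle has a nontrivial cycle. -/
theorem PeriodicPointsFixed.no_cycle_of_lift {H L : Type*} [Finite L] {F : L → L} {f : H → H}
    {φ : L → H} (hF : PeriodicPointsFixed F) (hφ : Function.Surjective φ)
    (comm : ∀ x, φ (F x) = f (φ x)) {k : ℕ} (hk : 1 < k) {g : Fin k → H}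
    (hg : Function.Injective g)
    (hfg : ∀ i j : Fin k, (j : ℕ) = ((i : ℕ) + 1) % k → f (g i) = g j) : False := by
  obtain ⟨x, hx⟩ := hφ (g ⟨0, by omega⟩)
  have it : ∀ n : ℕ, φ (F^[n] x) = g ⟨n % k, Nat.mod_lt _ (by omega)⟩ := by
    intro n
    induction n with
    | zero => simpa using hx
    | succ n ih =>
      rw [Function.iterate_succ_apply', comm, ih]
      exact hfg _ _ (by simp)
  obtain ⟨m, n, hmn, e⟩ := Finite.exists_ne_map_eq_of_infinite fun n : ℕ => F^[n] x
  wlog hlt : m < n generalizing m n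
  · exact this n m hmn.symm e.symm (by omega)
  -- The repetition makes `F^[m] x` periodic, hence fixed, while its image under `φ` has to move on
  -- along the cycle.
  have hfix : F (F^[m] x) = F^[m] x := by
    refine hF (n - m) (by omega) _ ?_
    rw [← Function.iterate_add_apply, Nat.sub_add_cancel hlt.le]
    exact e.symm
  have h₁ := it (m + 1)
  rw [Function.iterate_succ_apply', hfix, it m] at h₁
  have h₂ : m % k = (m + 1) % k := congrArg Fin.val (hg h₁)
  have h₃ := Nat.add_mod m 1 k
  rw [Nat.mod_eq_of_lt hk] at h₃
  have h₄ := Nat.mod_lt m (show k > 0 by omega)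
  rcases Nat.lt_or_ge (m % k + 1) k with h | h
  · rw [Nat.mod_eq_of_lt h] at h₃; omega
  · rw [show m % k + 1 = k by omega, Nat.mod_self] at h₃; omega

/-- In an aperiodic monoid, multiples become constant. -/
theorem nsmul_eq_of_le {H : Type*} [AddMonoid H] {m : ℕ} {h : H} (hm : m • h = (m + 1) • h)
    {n : ℕ} (hn : m ≤ n) : n • h = m • h := by
  induction n, hn using Nat.le_induction with
  | base => rfl
  | succ n hn ih => rw [succ_nsmul, ih, ← succ_nsmul, ← hm]

/-- A periodic point is its own image under arbitrarily high powers of `x`, and by aperiodicity a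
further factor `x` does not change these. -/
theorem periodicPointsFixed_smul {V H : Type*} [Monoid V] [MulAction V H] {m : ℕ}
    {x : V} (hx : x ^ m = x ^ (m + 1)) : PeriodicPointsFixed fun h : H => x • h := by
  intro d hd h e
  have it : ∀ n, (fun h : H => x • h)^[n] h = x ^ n • h := by
    intro n
    induction n with
    | zero => simp
    | succ n ih => rw [Function.iterate_succ_apply', ih, pow_succ', mul_smul]
  have e' : ∀ n, x ^ (d * n) • h = h := by
    intro n
    induction n with
    | zero => simp
    | succ n ih => rw [Nat.mul_succ, pow_add, mul_smul, ← it d, e, ih]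
  have hm : ∀ n, m ≤ n → x ^ n = x ^ m := by
    intro n hn
    induction n, hn using Nat.le_induction with
    | base => rfl
    | succ n hn ih => rw [pow_succ, ih, ← pow_succ, ← hx]
  have hle : m ≤ d * m := Nat.le_mul_of_pos_left m hd
  change x • h = h
  calc x • h = x • x ^ (d * m) • h := by rw [e']
    _ = x ^ (d * m + 1) • h := by rw [pow_succ', mul_smul]
    _ = x ^ (d * m) • h := by rw [hm _ (by omega), hm _ hle]
    _ = h := e' m

/-! ### Maps given by multicontexts, and their decomposition in wreath products -/

namespace ForestAlgebra

/-- The maps `H → H` given by multicontexts with the same value at all holes. -/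
inductive PolyFun (X : ForestAlgebra.{u}) : (X.H → X.H) → Prop
  | id : PolyFun X fun h => h
  | zero : PolyFun X fun _ => 0
  | add {f g : X.H → X.H} : PolyFun X f → PolyFun X g → PolyFun X fun h => f h + g h
  | smul (x : X.V) {f : X.H → X.H} : PolyFun X f → PolyFun X fun h => x • f h

/-- The maps `H → H` given by uniform multicontexts with the same value at all holes. -/
inductive UniformFun (X : ForestAlgebra.{u}) : (X.H → X.H) → Prop
  | id : UniformFun X fun h => h
  | nsmul_smul (n : ℕ) (x : X.V) {f : X.H → X.H} :
      UniformFun X f → UniformFun X fun h => n • x • f h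

/-- First components are computed without looking at second ones. Once the first component of the
argument is frozen, those of all intermediate values are too, so every vertical element acts on
second components through a single element of `Y.V`. -/
theorem PolyFun.wreath {X Y : ForestAlgebra.{u}} {F : (X.wreath Y).H → (X.wreath Y).H}
    (hF : PolyFun (X.wreath Y) F) :
    ∃ f, PolyFun X f ∧ (∀ h : X.H × Y.H, (F h : X.H × Y.H).1 = f h.1) ∧
      ∀ x : X.H, ∃ f', PolyFun Y f' ∧ ∀ y : Y.H, (F (x, y) : X.H × Y.H).2 = f' y := by
  induction hF with
  | id => exact ⟨_, .id, fun _ => rfl, fun x => ⟨_, .id, fun _ => rfl⟩⟩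
  | zero => exact ⟨_, .zero, fun _ => rfl, fun x => ⟨_, .zero, fun _ => rfl⟩⟩
  | add _ _ ih₁ ih₂ =>
    obtain ⟨f₁, hf₁, e₁, k₁⟩ := ih₁
    obtain ⟨f₂, hf₂, e₂, k₂⟩ := ih₂
    refine ⟨_, .add hf₁ hf₂, fun h => congrArg₂ (· + ·) (e₁ h) (e₂ h), fun x => ?_⟩
    obtain ⟨g₁, hg₁, d₁⟩ := k₁ x
    obtain ⟨g₂, hg₂, d₂⟩ := k₂ x
    exact ⟨_, .add hg₁ hg₂, fun y => congrArg₂ (· + ·) (d₁ y) (d₂ y)⟩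
  | smul w _ ih =>
    obtain ⟨f, hf, e, k⟩ := ih
    refine ⟨_, .smul (WreathV.fst w) hf, fun h => congrArg (WreathV.fst w • ·) (e h), fun x => ?_⟩
    obtain ⟨g, hg, d⟩ := k x
    exact ⟨_, .smul (WreathV.snd w (f x)) hg, fun y =>
      congrArg₂ (fun a b => WreathV.snd w a • b) (e (x, y)) (d y)⟩

theorem wreath_nsmul {X Y : ForestAlgebra.{u}} (n : ℕ) (h : X.H × Y.H) :
    (n • (h : (X.wreath Y).H) : (X.wreath Y).H) = (n • h.1, n • h.2) := by
  induction n with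
  | zero => rw [zero_nsmul, zero_nsmul, zero_nsmul]; rfl
  | succ n ih => rw [succ_nsmul, ih, succ_nsmul, succ_nsmul]; rfl

theorem UniformFun.wreath {X Y : ForestAlgebra.{u}} {F : (X.wreath Y).H → (X.wreath Y).H}
    (hF : UniformFun (X.wreath Y) F) :
    ∃ f, UniformFun X f ∧ (∀ h : X.H × Y.H, (F h : X.H × Y.H).1 = f h.1) ∧
      ∀ x : X.H, ∃ f', UniformFun Y f' ∧ ∀ y : Y.H, (F (x, y) : X.H × Y.H).2 = f' y := by
  induction hF with
  | id => exact ⟨_, .id, fun _ => rfl, fun x => ⟨_, .id, fun _ => rfl⟩⟩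
  | nsmul_smul n w _ ih =>
    obtain ⟨f, hf, e, k⟩ := ih
    refine ⟨_, .nsmul_smul n (WreathV.fst w) hf, fun h => ?_, fun x => ?_⟩
    · exact (congrArg Prod.fst (wreath_nsmul n _)).trans
        (congrArg (fun a => n • WreathV.fst w • a) (e h))
    · obtain ⟨g, hg, d⟩ := k x
      exact ⟨_, .nsmul_smul n (WreathV.snd w (f x)) hg, fun y =>
        (congrArg Prod.snd (wreath_nsmul n _)).trans
          (congrArg₂ (fun a b => n • WreathV.snd w a • b) (e (x, y)) (d y))⟩

theorem IsIteratedWreath.finite {C : ForestAlgebra.{u} → Prop} (hC : ∀ X, C X → Finite X.H)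
    {X : ForestAlgebra.{u}} (hX : IsIteratedWreath C X) : Finite X.H := by
  induction hX with
  | base h => exact hC _ h
  | @wreath X Y _ _ ih₁ ih₂ => exact inferInstanceAs (Finite (X.H × Y.H))

theorem IsIteratedWreath.polyFun_fixed {C : ForestAlgebra.{u} → Prop}
    (hC : ∀ X, C X → ∀ f, PolyFun X f → PeriodicPointsFixed f)
    {X : ForestAlgebra.{u}} (hX : IsIteratedWreath C X) :
    ∀ f, PolyFun X f → PeriodicPointsFixed f := by
  induction hX with
  | base h => exact hC _ h
  | wreath _ _ ih₁ ih₂ =>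
    intro F hF
    obtain ⟨f, hf, e, k⟩ := hF.wreath
    choose f' hf' d using k
    exact PeriodicPointsFixed.skewProduct e d (ih₁ f hf) fun x => ih₂ _ (hf' x)

theorem IsIteratedWreath.uniformFun_fixed {C : ForestAlgebra.{u} → Prop}
    (hC : ∀ X, C X → ∀ f, UniformFun X f → PeriodicPointsFixed f)
    {X : ForestAlgebra.{u}} (hX : IsIteratedWreath C X) :
    ∀ f, UniformFun X f → PeriodicPointsFixed f := by
  induction hX with
  | base h => exact hC _ h
  | wreath _ _ ih₁ ih₂ =>
    intro F hF
    obtain ⟨f, hf, e, k⟩ := hF.wreath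
    choose f' hf' d using k
    exact PeriodicPointsFixed.skewProduct e d (ih₁ f hf) fun x => ih₂ _ (hf' x)

/-! ### The algebra `𝒰₂` -/

instance : Finite U₂H :=
  Finite.of_surjective (fun b : Bool => if b then U₂H.infty else U₂H.zero) <| by
    rintro (_ | _)
    · exact ⟨false, rfl⟩
    · exact ⟨true, rfl⟩

/-- The maps of `𝒰₂` given by multicontexts are monotone. -/
theorem U₂_polyFun_monotone {f : U₂.H → U₂.H} (hf : PolyFun U₂ f) :
    f U₂H.zero = U₂H.infty → f U₂H.infty = U₂H.infty := by
  induction hf with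
  | id => exact fun _ => rfl
  | zero => exact id
  | @add f g _ _ ih₁ ih₂ =>
    intro h
    change (f U₂H.zero + g U₂H.zero : U₂H) = .infty at h
    change (f U₂H.infty + g U₂H.infty : U₂H) = .infty
    cases h₁ : f U₂H.zero with
    | infty => rw [ih₁ h₁]; rfl
    | zero =>
      rw [h₁] at h
      rw [ih₂ h]
      cases f U₂H.infty <;> rfl
  | @smul x f _ ih =>
    intro h
    rcases x with _ | c
    · exact ih h
    · exact h

/-- A periodic point that is not fixed would force `f` to exchange the two elements, which a
monotone map cannot do. -/
theorem U₂_polyFun_fixed (f : U₂H → U₂H) (hf : PolyFun U₂ f) : PeriodicPointsFixed f := by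
  have hm := U₂_polyFun_monotone hf
  intro d hd h e
  by_contra hne
  obtain ⟨d, rfl⟩ : ∃ n, d = n + 1 := ⟨d - 1, by omega⟩
  rw [Function.iterate_succ_apply] at e
  cases h with
  | zero =>
    cases h₀ : f .zero with
    | zero => exact hne h₀
    | infty => rw [h₀, show f^[d] U₂H.infty = U₂H.infty from Function.iterate_fixed (hm h₀) d] at e; cases e
  | infty =>
    cases h₁ : f .infty with
    | infty => exact hne h₁
    | zero =>
      cases h₀ : f .zero with
      | zero => rw [h₁, show f^[d] U₂H.zero = U₂H.zero from Function.iterate_fixed h₀ d] at e; cases e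
      | infty => exact hne (hm h₀)

/-! ### Uniform multicontexts in aperiodic path algebras -/

section

variable {X : ForestAlgebra.{u}}

/-- By the first path identity, merging one more summand into the argument of `x` costs one `x • 0`.
-/
theorem IsPathAlgebra.nsmul_smul (hX : X.IsPathAlgebra) (n : ℕ) (x : X.V) (h : X.H) :
    (n + 1) • x • h = x • (n + 1) • h + n • x • (0 : X.H) := by
  induction n with
  | zero => simp
  | succ n ih =>
    rw [succ_nsmul, ih, add_assoc, hX.add_comm (n • x • (0 : X.H)), ← add_assoc,
      hX.smul_add_smul, ← succ_nsmul, add_assoc, ← succ_nsmul']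

/-- Multiplication by `n` can be moved inside. -/
theorem IsPathAlgebra.exists_nsmul_smul (hX : X.IsPathAlgebra) (n : ℕ) (x : X.V) :
    ∃ y : X.V, (∀ h : X.H, n • x • h = y • n • h) := by
  cases n with
  | zero => exact ⟨1, fun h => by simp⟩
  | succ n =>
    -- The correction does not depend on `h`, so a translation accounts for it.
    obtain ⟨t, ht⟩ := X.exists_smul_eq_add_right (n • x • (0 : X.H))
    exact ⟨t * x, fun h => by rw [hX.nsmul_smul, mul_smul, ht]⟩

/-- The multiplicities of all levels can be moved down to the holes, where they multiply. -/
theorem UniformFun.exists_eq (hX : X.IsPathAlgebra) {f : X.H → X.H} (hf : UniformFun X f) :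
    ∃ (x : X.V) (n : ℕ), ∀ h, f h = x • n • h := by
  induction hf with
  | id => exact ⟨1, 1, fun h => by simp⟩
  | nsmul_smul m y _ ih =>
    obtain ⟨x, n, hx⟩ := ih
    obtain ⟨z, hz⟩ := hX.exists_nsmul_smul m (y * x)
    exact ⟨z, m * n, fun h => by simp only [hx]; rw [← mul_smul y x, hz, mul_nsmul']⟩

theorem IsAperiodicPathAlgebra.uniformFun_fixed (hX : X.IsAperiodicPathAlgebra)
    (f : X.H → X.H) (hf : UniformFun X f) : PeriodicPointsFixed f := by
  obtain ⟨x, n, hx⟩ := hf.exists_eq hX.toIsPathAlgebra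
  obtain ⟨m, hm, hH⟩ := hX.aperiodic_H
  obtain ⟨r, -, hV⟩ := hX.aperiodic_V
  intro d hd h e
  rcases Nat.lt_or_ge n 2 with hn | hn
  · interval_cases n
    · obtain ⟨d, rfl⟩ : ∃ n, d = n + 1 := ⟨d - 1, by omega⟩
      rw [Function.iterate_succ_apply'] at e
      rw [hx, zero_nsmul] at e ⊢
      exact e
    · have hfx : f = fun h => x • h := funext fun h => by rw [hx, one_nsmul]
      rw [hfx] at e ⊢
      exact periodicPointsFixed_smul (hV x) d hd h e
  -- For `n ≥ 2` the multiplicity `n ^ k` grows, so high iterates of `f` depend on `h` only through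
  -- the stable multiple `m • h`.
  · have it : ∀ k, ∃ y : X.V, ∀ h, f^[k] h = y • n ^ k • h := by
      intro k
      induction k with
      | zero => exact ⟨1, fun h => by simp⟩
      | succ k ih =>
        obtain ⟨y, hy⟩ := ih
        obtain ⟨z, hz⟩ := hX.exists_nsmul_smul (n ^ k) x
        exact ⟨y * z, fun h => by
          rw [Function.iterate_succ_apply, hy, hx, hz, ← mul_nsmul', ← pow_succ, mul_smul]⟩
    have hper : ∀ k, f^[d * k] h = h := by
      intro k
      induction k with
      | zero => rfl
      | succ k ih => rw [Nat.mul_succ, Function.iterate_add_apply, e, ih]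
    -- The factor `d` makes this iterate fix `h`; the factor `m` makes its multiplicity at least
    -- `m`.
    obtain ⟨y, hy⟩ := it (d * m)
    have hle : m ≤ n ^ (d * m) :=
      (Nat.le_mul_of_pos_left m hd).trans (Nat.lt_pow_self (by omega)).le
    have hy' : ∀ z : X.H, f^[d * m] z = y • m • z := fun z => by
      rw [hy, nsmul_eq_of_le (hH z) hle]
    -- On stable multiples `f` induces the action of one element `w`, so aperiodicity of `V` shows
    -- that `m • h` is fixed.
    obtain ⟨w, hw⟩ := hX.exists_nsmul_smul m x
    have hE : ∀ z, m • f z = w • m • z := fun z => by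
      rw [hx, hw, ← mul_nsmul', nsmul_eq_of_le (hH z) (Nat.le_mul_of_pos_right m (by omega))]
    have hEit : ∀ k, (fun z : X.H => w • z)^[k] (m • h) = m • f^[k] h := by
      intro k
      induction k with
      | zero => rfl
      | succ k ih => rw [Function.iterate_succ_apply', ih, Function.iterate_succ_apply', hE]
    have hfix : w • m • h = m • h :=
      periodicPointsFixed_smul (hV w) d hd (m • h) (by rw [hEit, e])
    calc f h = f (f^[d * m] h) := by rw [hper]
      _ = f^[d * m] (f h) := by rw [← Function.iterate_succ_apply' f, Function.iterate_succ_apply]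
      _ = f^[d * m] h := by rw [hy', hE, hfix, hy']
      _ = h := hper m

end

end ForestAlgebra

/-! ### Horizontal confusion in path algebras -/

/-- Polynomials over `(V, H)` with one variable, each of whose occurrences is a hole. -/
inductive ForestPoly (V : Type*) (H : Type*)
  | hole
  | const (h : H)
  | add (p q : ForestPoly V H)
  | act (x : V) (p : ForestPoly V H)

namespace ForestPoly

variable {V H : Type*}

section

variable [Add H] [SMul V H]

/-- The values of a polynomial when the values of the holes range over `G`. -/
def vals (G : Set H) : ForestPoly V H → Set H
  | hole => G
  | const h => {h}
  | add p q => Set.image2 (· + ·) (p.vals G) (q.vals G)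
  | act x p => (x • ·) '' p.vals G

/-- `p.Fixed S G A` says that `A` is the set of values of `p` when the value of one fixed hole
ranges over `S`, and those of the others over `G`. -/
inductive Fixed (S G : Set H) : ForestPoly V H → Set H → Prop
  | hole : Fixed S G hole S
  | add_left {p : ForestPoly V H} {A : Set H} (q : ForestPoly V H) :
      Fixed S G p A → Fixed S G (add p q) (Set.image2 (· + ·) A (q.vals G))
  | add_right {q : ForestPoly V H} {A : Set H} (p : ForestPoly V H) :
      Fixed S G q A → Fixed S G (add p q) (Set.image2 (· + ·) (p.vals G) A)
  | act {p : ForestPoly V H} {A : Set H} (x : V) :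
      Fixed S G p A → Fixed S G (act x p) ((x • ·) '' A)

/-- Horizontal confusion with respect to a polynomial. -/
def Confusion (p : ForestPoly V H) (G : Set H) : Prop :=
  G.Nontrivial ∧ G ⊆ p.vals G ∧ ∀ g ∈ G, ∀ A, p.Fixed {g} G A → G ⊆ A

end

end ForestPoly

/-- The exponent is kept positive because the power must later belong to a product of confusing
families. -/
theorem exists_pow_idempotent {M : Type*} [Monoid M] [Finite M] (a : M) :
    ∃ n : ℕ, a ^ (n + 1) * a ^ (n + 1) = a ^ (n + 1) := by
  obtain ⟨i, j, hij, e⟩ := Finite.exists_ne_map_eq_of_infinite fun n : ℕ => a ^ n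
  wlog hlt : i < j generalizing i j
  · exact this j i hij.symm e.symm (by omega)
  obtain ⟨p, rfl⟩ : ∃ p, j = i + (p + 1) := ⟨j - i - 1, by omega⟩
  have hk : ∀ k, i ≤ k → a ^ (k + (p + 1)) = a ^ k := by
    intro k hk
    obtain ⟨l, rfl⟩ := Nat.exists_eq_add_of_le hk
    rw [show i + l + (p + 1) = (i + (p + 1)) + l by ring, pow_add, ← show a ^ i = _ from e, pow_add]
  have ht : ∀ t k, i ≤ k → a ^ (k + t * (p + 1)) = a ^ k := by
    intro t
    induction t with
    | zero => simp
    | succ t ih => intro k hik; rw [Nat.succ_mul, ← add_assoc, hk _ (by omega), ih k hik]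
  -- This makes the exponent `(i + 1) * (p + 1)`, a multiple of the period `p + 1` beyond the
  -- preperiod `i`.
  refine ⟨i * (p + 1) + p, ?_⟩
  rw [show i * (p + 1) + p + 1 = (i + 1) * (p + 1) by ring, ← pow_add, ht]
  nlinarith [Nat.zero_le (i * p)]

/-! ### Absorption by idempotents in path algebras -/

section PathAlgebra

variable {V H : Type*} [AddCommMonoid H] [Monoid V] [MulAction V H]

/-- The laws of path algebras, for a commutative monoid `H`; `t s` is the context `s + □`. -/
structure PathLaws (t : H → V) : Prop where
  smul_eq_add : ∀ s g : H, t s • g = s + g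
  aperiodic : ∃ m : ℕ, ∀ h : H, m • h = (m + 1) • h
  smul_add_smul : ∀ (x : V) (g h : H), x • g + x • h = x • (g + h) + x • (0 : H)
  idem_smul_add : ∀ x : V, x * x = x → ∀ g h : H, x • (g + h) = x • (g + x • h)

/-- Adding `d` does not change the value of the context `u`. -/
def AbsorbsSummand (u : V) (d : H) : Prop :=
  ∀ z : H, u • (z + d) = u • z

theorem AbsorbsSummand.add {u : V} {c d : H} (hc : AbsorbsSummand u c) (hd : AbsorbsSummand u d) :
    AbsorbsSummand u (c + d) := fun z => by rw [← add_assoc, hd, hc]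

theorem AbsorbsSummand.nsmul {u : V} {d : H} (hd : AbsorbsSummand u d) (n : ℕ) : AbsorbsSummand u (n • d) := by
  induction n with
  | zero => intro z; simp
  | succ n ih => rw [succ_nsmul]; exact ih.add hd

namespace PathLaws

variable {t : H → V}

/-- The multiple `m • (c + d)` may be added freely under `u`, and by aperiodicity it swallows one
more `d`. -/
theorem absorbs_of_add (L : PathLaws t) {u : V} {c d : H} (h : AbsorbsSummand u (c + d)) :
    AbsorbsSummand u d := by
  obtain ⟨m, hm⟩ := L.aperiodic
  intro z
  calc u • (z + d) = u • (z + d + m • (c + d)) := (h.nsmul m _).symm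
    _ = u • (z + (m • c + (m + 1) • d)) := by
      rw [nsmul_add, succ_nsmul]; congr 1; abel
    _ = u • (z + m • (c + d)) := by rw [← hm, nsmul_add]
    _ = u • z := h.nsmul m z

/-- The second path identity replaces `d` by `u • d`, which equals `u • 0`, and then removes it. -/
theorem absorbs_of_smul_eq (L : PathLaws t) {u : V} (hu : u * u = u) {d : H}
    (h : u • d = u • (0 : H)) : AbsorbsSummand u d := fun z => by
  rw [L.idem_smul_add u hu, h, ← L.idem_smul_add u hu, add_zero]

/-- An idempotent absorbs the values at `0` of its left factors. -/
theorem absorbs_smul_zero (L : PathLaws t) {u q r : V} (hu : u * u = u) (h : u = q * r) :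
    AbsorbsSummand u (q • (0 : H)) := by
  have e : q • r • u • (0 : H) = u • (0 : H) := by
    rw [← mul_smul q, ← h, ← mul_smul, hu]
  -- This exhibits `q • 0` as a summand of `u • 0 + u • 0`, a sum that `u` absorbs.
  have e' := L.smul_add_smul q (r • u • (0 : H)) (r • u • (0 : H))
  rw [e] at e'
  refine L.absorbs_of_add (c := q • (r • u • (0 : H) + r • u • (0 : H)))
    (L.absorbs_of_smul_eq hu ?_)
  rw [← e', ← L.idem_smul_add u hu, add_zero, ← mul_smul, hu]

/-- An idempotent `u` induces a partial order on its image: `u h` is below `u g` if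
`u h = u (g + f)` for some `f`. -/
theorem smul_eq_of_le_of_le (L : PathLaws t) {u : V} (hu : u * u = u) {g h f f' : H}
    (h₁ : u • h = u • (g + f)) (h₂ : u • g = u • (h + f')) : u • h = u • g := by
  obtain ⟨m, hm⟩ := L.aperiodic
  have I : ∀ a b : H, u • (a + u • b) = u • (a + b) := fun a b => (L.idem_smul_add u hu a b).symm
  have e : u • h = u • (h + (f' + f)) := by
    rw [h₁, add_comm g, ← I, h₂, I]; congr 1; abel
  have e' : ∀ n : ℕ, u • h = u • (h + n • (f' + f)) := by
    intro n
    induction n with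
    | zero => simp
    | succ n ih =>
      rw [ih, add_comm h, ← I, e, I, succ_nsmul]; congr 1; abel
  symm
  -- Going up and down `m` times leaves `u • h` unchanged and supplies enough copies of `f'` to
  -- swallow the single one that separates `g` from `h`.
  calc u • g = u • (f' + h) := by rw [h₂, add_comm]
    _ = u • (f' + (h + m • (f' + f))) := by rw [← I, e' m, I]
    _ = u • (h + (m • f + (m + 1) • f')) := by rw [nsmul_add, succ_nsmul]; congr 1; abel
    _ = u • (h + m • (f' + f)) := by rw [← hm, nsmul_add, add_comm (m • f)]
    _ = u • h := (e' m).symm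

end PathLaws

/-! ### Linearization of contexts along a path -/

/-- `x • z` is the sum of `c` and `v • z`, up to the correction `d`. -/
def IsLinearization (x v : V) (d c : H) : Prop :=
  ∀ z : H, x • z + d = c + v • z

/-- The first path identity splits `v • (s + w • z) + v • 0`. The new linear part and correction do
not involve `s`, so contexts on the same path share them. -/
theorem IsLinearization.mul {t : H → V} (L : PathLaws t) {x v : V} {d c : H}
    (h : IsLinearization x v d c) (s : H) (w : V) :
    IsLinearization (x * (t s * w)) (v * w) (d + v • (0 : H)) (c + v • s) := fun z => by
  rw [mul_smul, mul_smul, L.smul_eq_add, ← add_assoc, h, add_assoc, ← L.smul_add_smul,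
    mul_smul, add_assoc]

/-- The sets of contexts `s₁ + v₁(s₂ + v₂(⋯ (sₙ + vₙ □)))` where the `vᵢ` are fixed and the `sᵢ`
range over given sets. -/
inductive IsPathFamily (t : H → V) : Set V → Prop
  | one : IsPathFamily t {1}
  | snoc {C : Set V} (S : Set H) (v : V) :
      IsPathFamily t C → IsPathFamily t (Set.image2 (fun x s => x * (t s * v)) C S)

omit [AddCommMonoid H] [MulAction V H] in
theorem IsPathFamily.mul {t : H → V} {B C : Set V} (hB : IsPathFamily t B)
    (hC : IsPathFamily t C) : IsPathFamily t (Set.image2 (· * ·) B C) := by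
  induction hC with
  | one => simpa using hB
  | snoc S v _ ih =>
    rw [← Set.image2_assoc (f := fun x s => x * (t s * v)) (g := (· * ·))]
    · exact ih.snoc S v
    · intro a b c; simp only [mul_assoc]

/-- Two contexts on the same path have linearizations that differ only in the constant, and the
correction and the constant of the first are absorbed by all idempotents that it is a left factor
of. -/
theorem IsPathFamily.exists_linearization {t : H → V} (L : PathLaws t) {C : Set V}
    (hC : IsPathFamily t C) {u : V} (hu : u * u = u) :
    ∀ x ∈ C, ∀ y ∈ C, ∀ r, u = x * r → ∃ (v : V) (d c c' : H),
      IsLinearization x v d c ∧ IsLinearization y v d c' ∧ AbsorbsSummand u d ∧ AbsorbsSummand u c := by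
  induction hC with
  | one =>
    rintro x rfl y rfl r -
    exact ⟨1, 0, 0, 0, fun z => by simp, fun z => by simp, fun z => by simp, fun z => by simp⟩
  | snoc S w _ ih =>
    rintro _ ⟨x, hx, s, hs, rfl⟩ _ ⟨y, hy, s', hs', rfl⟩ r hr
    obtain ⟨v, d, c, c', hxv, hyv, hd, hc⟩ := ih x hx y hy _ (hr.trans (mul_assoc _ _ _))
    -- By linearization at `0`, this is a summand of `x • 0 + d`, and `x` is a left factor of `u`.
    have h₀ : AbsorbsSummand u (v • (0 : H)) := by
      refine L.absorbs_of_add (c := c) ?_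
      rw [← hxv]
      exact (L.absorbs_smul_zero hu (hr.trans (mul_assoc _ _ _))).add hd
    -- Likewise `v • s` is a summand of `x • s + d`, where `x • s` is the value at `0` of the left
    -- factor `x * t s`.
    have h₁ : AbsorbsSummand u (v • s) := by
      refine L.absorbs_of_add (c := c) ?_
      rw [← hxv]
      refine AbsorbsSummand.add ?_ hd
      have := L.absorbs_smul_zero hu (q := x * t s) (r := w * r) (by simp only [hr, mul_assoc])
      rwa [mul_smul, L.smul_eq_add, add_zero] at this
    exact ⟨v * w, _, _, _, hxv.mul L s w, hyv.mul L s' w, hd.add h₀, hc.add h₁⟩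

/-- A path family along which every element of `G` can be sent to every element of `G`. -/
def IsConfusingFamily (t : H → V) (G : Set H) (C : Set V) : Prop :=
  IsPathFamily t C ∧ ∀ g ∈ G, ∀ h ∈ G, ∃ x ∈ C, x • g = h

omit [AddCommMonoid H] in
theorem IsConfusingFamily.mul {t : H → V} {G : Set H} {B C : Set V}
    (hB : IsConfusingFamily t G B) (hC : IsConfusingFamily t G C) :
    IsConfusingFamily t G (Set.image2 (· * ·) B C) := by
  refine ⟨hB.1.mul hC.1, fun g hg h hh => ?_⟩
  obtain ⟨x, hx, e⟩ := hB.2 h hh h hh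
  obtain ⟨y, hy, e'⟩ := hC.2 g hg h hh
  exact ⟨x * y, ⟨x, hx, y, hy, rfl⟩, by rw [mul_smul, e', e]⟩

omit [AddCommMonoid H] in
theorem IsConfusingFamily.exists_pow {t : H → V} {G : Set H} {C : Set V}
    (hC : IsConfusingFamily t G C) {x : V} (hx : x ∈ C) (n : ℕ) :
    ∃ B, IsConfusingFamily t G B ∧ x ^ (n + 1) ∈ B := by
  induction n with
  | zero => exact ⟨C, hC, by simpa using hx⟩
  | succ n ih =>
    obtain ⟨B, hB, hxB⟩ := ih
    exact ⟨_, hB.mul hC, x ^ (n + 1), hxB, x, hx, (pow_succ x (n + 1)).symm⟩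

/-- The idempotents in confusing families are constant on `G`. -/
theorem IsConfusingFamily.smul_eq {t : H → V} (L : PathLaws t) {G : Set H} {C : Set V}
    (hC : IsConfusingFamily t G C) {u : V} (huC : u ∈ C) (hu : u * u = u) {g h : H}
    (hg : g ∈ G) (hh : h ∈ G) : u • g = u • h := by
  have le : ∀ g ∈ G, ∀ h ∈ G, ∃ f, u • h = u • (g + f) := by
    intro g hg h hh
    obtain ⟨y, hy, e⟩ := hC.2 g hg h hh
    obtain ⟨v, d, c, c', h₁, h₂, hd, hc⟩ :=
      hC.1.exists_linearization L hu u huC y hy 1 (mul_one u).symm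
    -- As `u` absorbs `c` and `d`, its own linearization shows that the linear part is invisible
    -- under `u`. The linearization of `y` then leaves only the summand `c'`.
    have e₁ : u • v • g = u • g := by
      rw [← hc (v • g), add_comm, ← h₁, hd, ← mul_smul, hu]
    refine ⟨c', ?_⟩
    rw [← hd h, ← e, h₂, L.idem_smul_add u hu, e₁, ← L.idem_smul_add u hu, add_comm]
  obtain ⟨f, hf⟩ := le g hg h hh
  obtain ⟨f', hf'⟩ := le h hh g hg
  exact (L.smul_eq_of_le_of_le hu hf hf').symm

/-! ### The contexts around a hole of a polynomial -/

namespace ForestPoly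

/-- The family of the contexts that are obtained from a polynomial by giving values in `G` to all
holes but one. -/
inductive IsHoleFamily (t : H → V) (G : Set H) : ForestPoly V H → Set V → Prop
  | hole : IsHoleFamily t G hole {1}
  | add_left {p : ForestPoly V H} {C : Set V} (q : ForestPoly V H) :
      IsHoleFamily t G p C →
        IsHoleFamily t G (add p q) (Set.image2 (fun s x => t s * x) (q.vals G) C)
  | add_right {q : ForestPoly V H} {C : Set V} (p : ForestPoly V H) :
      IsHoleFamily t G q C →
        IsHoleFamily t G (add p q) (Set.image2 (fun s x => t s * x) (p.vals G) C)
  | act {p : ForestPoly V H} {C : Set V} (v : V) :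
      IsHoleFamily t G p C → IsHoleFamily t G (act v p) ((v * ·) '' C)

/-- Adding a summand is a step of the path with `v = 1`, and applying `v` is a step with `s = 0`;
for the latter, faithfulness gives `t 0 = 1`. -/
theorem IsHoleFamily.isPathFamily {t : H → V} (L : PathLaws t) [FaithfulSMul V H] {G : Set H}
    {p : ForestPoly V H} {C : Set V} (hC : IsHoleFamily t G p C) : IsPathFamily t C := by
  have step : ∀ (S : Set H) {C : Set V}, IsPathFamily t C →
      IsPathFamily t (Set.image2 (fun s x => t s * x) S C) := by
    intro S C hC
    have := (IsPathFamily.one.snoc S 1).mul hC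
    simpa [Set.image2_image_left] using this
  induction hC with
  | hole => exact .one
  | add_left q _ ih => exact step _ ih
  | add_right p _ ih => exact step _ ih
  | act v _ ih =>
    have h₀ : t 0 = 1 := FaithfulSMul.eq_of_smul_eq_smul fun h : H => by
      rw [L.smul_eq_add, zero_add, one_smul]
    simpa [Set.image2_image_left, h₀] using (IsPathFamily.one.snoc {0} v).mul ih

/-- This turns the confusion hypothesis into transitivity of hole families on `G`. Commutativity
lets `t` put every other summand on the left. -/
theorem IsHoleFamily.fixed {t : H → V} (L : PathLaws t) {G S : Set H}
    {p : ForestPoly V H} {C : Set V} (hC : IsHoleFamily t G p C) :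
    p.Fixed S G (Set.image2 (· • ·) C S) := by
  induction hC with
  | hole => simpa using Fixed.hole
  | @add_left p C q _ ih =>
    convert Fixed.add_left q ih using 1
    ext z
    simp only [Set.mem_image2]
    constructor
    · rintro ⟨_, ⟨s, hs, x, hx, rfl⟩, g, hg, rfl⟩
      exact ⟨_, ⟨x, hx, g, hg, rfl⟩, s, hs, by rw [mul_smul, L.smul_eq_add, add_comm]⟩
    · rintro ⟨_, ⟨x, hx, g, hg, rfl⟩, s, hs, rfl⟩
      exact ⟨_, ⟨s, hs, x, hx, rfl⟩, g, hg, by rw [mul_smul, L.smul_eq_add, add_comm]⟩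
  | @add_right q C p _ ih =>
    convert Fixed.add_right p ih using 1
    ext z
    simp only [Set.mem_image2]
    constructor
    · rintro ⟨_, ⟨s, hs, x, hx, rfl⟩, g, hg, rfl⟩
      exact ⟨s, hs, _, ⟨x, hx, g, hg, rfl⟩, by rw [mul_smul, L.smul_eq_add]⟩
    · rintro ⟨s, hs, _, ⟨x, hx, g, hg, rfl⟩, rfl⟩
      exact ⟨_, ⟨s, hs, x, hx, rfl⟩, g, hg, by rw [mul_smul, L.smul_eq_add]⟩
  | @act p C v _ ih =>
    convert Fixed.act v ih using 1
    ext z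
    simp only [Set.mem_image2, Set.mem_image]
    constructor
    · rintro ⟨_, ⟨x, hx, rfl⟩, g, hg, rfl⟩
      exact ⟨_, ⟨x, hx, g, hg, rfl⟩, by rw [mul_smul]⟩
    · rintro ⟨_, ⟨x, hx, g, hg, rfl⟩, rfl⟩
      exact ⟨_, ⟨x, hx, rfl⟩, g, hg, by rw [mul_smul]⟩

/-- If `w C` is constant on `G` for all contexts `C` obtained from `p`, then `w` is constant on
the values of `p`: the values of the holes can be changed one by one. -/
theorem smul_eq_of_holeFamily {t : H → V} (L : PathLaws t) {G : Set H} (p : ForestPoly V H) (w : V)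
    (hw : ∀ C, IsHoleFamily t G p C → ∀ x ∈ C, ∀ g ∈ G, ∀ h ∈ G, (w * x) • g = (w * x) • h) :
    ∀ a ∈ p.vals G, ∀ b ∈ p.vals G, w • a = w • b := by
  induction p generalizing w with
  | hole =>
    intro a ha b hb
    simpa using hw _ .hole 1 rfl a ha b hb
  | const h =>
    rintro a rfl b rfl
    rfl
  | add p q ihp ihq =>
    rintro _ ⟨a, ha, a', ha', rfl⟩ _ ⟨b, hb, b', hb', rfl⟩
    -- The first summand is changed while the second stays at `a'`; then the second is changed while
    -- the first stays at `b`.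
    have e₁ := ihp (w * t a') (fun C hC x hx g hg h hh => by
      rw [mul_assoc]
      exact hw _ (hC.add_left q) _ ⟨a', ha', x, hx, rfl⟩ g hg h hh) a ha b hb
    have e₂ := ihq (w * t b) (fun C hC x hx g hg h hh => by
      rw [mul_assoc]
      exact hw _ (hC.add_right p) _ ⟨b, hb, x, hx, rfl⟩ g hg h hh) a' ha' b' hb'
    simp only [mul_smul, L.smul_eq_add] at e₁ e₂
    change w • (a + a') = w • (b + b')
    rw [add_comm a, e₁, add_comm a', e₂]
  | act v p ih =>
    rintro _ ⟨a, ha, rfl⟩ _ ⟨b, hb, rfl⟩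
    have := ih (w * v) (fun C hC x hx g hg h hh => by
      rw [mul_assoc]
      exact hw _ (hC.act v) _ ⟨x, hx, rfl⟩ g hg h hh) a ha b hb
    simpa only [mul_smul] using this

/-- Path algebras do not have horizontal confusion. -/
theorem not_confusion_of_pathLaws {t : H → V} (L : PathLaws t) [FaithfulSMul V H] [Finite V]
    (p : ForestPoly V H) (G : Set H) : ¬ p.Confusion G := by
  rintro ⟨hG, hpG, hfix⟩
  have hconf : ∀ C, IsHoleFamily t G p C → IsConfusingFamily t G C := by
    refine fun C hC => ⟨hC.isPathFamily L, fun g hg h hh => ?_⟩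
    obtain ⟨x, hx, _, rfl, e⟩ := hfix g hg _ (hC.fixed L) hh
    exact ⟨x, hx, e⟩
  let W : Type _ := {w : V // ∃ g ∈ G, ∃ h ∈ G, w • g ≠ w • h}
  let R : W → W → Prop := fun w w' =>
    ∃ C, IsConfusingFamily t G C ∧ ∃ x ∈ C, (w' : V) = w * x
  -- Otherwise `w` would be constant on the values of `p`, and these include `G`.
  have hR : ∀ w : W, ∃ w' : W, R w w' := by
    rintro ⟨w, g, hg, h, hh, hne⟩
    by_contra! hcon
    refine hne (smul_eq_of_holeFamily L p w (fun C hC x hx a ha b hb => ?_) g (hpG hg) h (hpG hh))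
    by_contra hab
    exact hcon ⟨w * x, a, ha, b, hb, hab⟩ ⟨C, hconf C hC, x, hx, rfl⟩
  have hRt : ∀ a b c : W, R a b → R b c → R a c := by
    rintro a b c ⟨C, hC, x, hx, e⟩ ⟨D, hD, y, hy, e'⟩
    exact ⟨_, hC.mul hD, x * y, ⟨x, hx, y, hy, rfl⟩, by rw [e', e, mul_assoc]⟩
  choose next hnext using hR
  obtain ⟨g₀, hg₀, h₀, hh₀, hne₀⟩ := hG
  let w₀ : W := ⟨1, g₀, hg₀, h₀, hh₀, by simpa using hne₀⟩
  have hlt : ∀ i k : ℕ, R (next^[i] w₀) (next^[i + k + 1] w₀) := by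
    intro i k
    induction k with
    | zero => rw [add_zero, Function.iterate_succ_apply']; exact hnext _
    | succ k ih =>
      rw [Function.iterate_succ_apply' next (i + (k + 1))]
      exact hRt _ _ _ ih (hnext _)
  -- A repetition in the chain gives `w = w * x` with `w` not constant on `G` and `x` in a confusing
  -- family.
  obtain ⟨i, j, hij, e⟩ := Finite.exists_ne_map_eq_of_infinite fun n : ℕ => next^[n] w₀
  wlog hlt' : i < j generalizing i j
  · exact this j i hij.symm e.symm (by omega)
  obtain ⟨C, hC, x, hx, hw⟩ := hlt i (j - i - 1)
  rw [show i + (j - i - 1) + 1 = j by omega, ← show next^[i] w₀ = _ from e] at hw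
  obtain ⟨n, hn⟩ := exists_pow_idempotent x
  obtain ⟨B, hB, hxB⟩ := hC.exists_pow hx n
  revert hw
  obtain ⟨w, g, hg, h, hh, hne⟩ := next^[i] w₀
  intro hw
  change w = w * x at hw
  have hpow : ∀ k : ℕ, w * x ^ k = w := by
    intro k
    induction k with
    | zero => simp
    | succ k ih => rw [pow_succ, ← mul_assoc, ih, ← hw]
  refine hne ?_
  rw [← hpow (n + 1), mul_smul, mul_smul, hB.smul_eq L hxB hn hg hh]

end ForestPoly

end PathAlgebra

universe u₂

namespace ForestPoly

/-! ### Substitution and lifting of horizontal confusion -/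

section

variable {V H : Type*} [Add H] [SMul V H]

theorem vals_mono {G G' : Set H} (h : G ⊆ G') (p : ForestPoly V H) : p.vals G ⊆ p.vals G' := by
  induction p with
  | hole => exact h
  | const _ => exact subset_rfl
  | add p q ihp ihq => exact Set.image2_subset ihp ihq
  | act x p ih => exact Set.image_mono ih

theorem Fixed.subset_vals {S G A : Set H} {p : ForestPoly V H} (h : p.Fixed S G A) (hS : S ⊆ G) :
    A ⊆ p.vals G := by
  induction h with
  | hole => exact hS
  | add_left q _ ih => exact Set.image2_subset ih subset_rfl
  | add_right p _ ih => exact Set.image2_subset subset_rfl ih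
  | act x _ ih => exact Set.image_mono ih

theorem Fixed.vals_subset {S G A B : Set H} {p : ForestPoly V H} (h : p.Fixed S G A) (hS : B ⊆ S)
    (hG : B ⊆ G) : p.vals B ⊆ A := by
  induction h with
  | hole => exact hS
  | add_left q _ ih => exact Set.image2_subset ih (vals_mono hG q)
  | add_right p _ ih => exact Set.image2_subset (vals_mono hG p) ih
  | act x _ ih => exact Set.image_mono ih

/-- A hole that is fixed to one value can be replaced by a constant. -/
theorem Fixed.exists_plug {k : H} {G A : Set H} {p : ForestPoly V H} (h : p.Fixed {k} G A) :
    ∃ q : ForestPoly V H, q.vals G = A ∧ ∀ G', p.Fixed {k} G' (q.vals G') := by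
  induction h with
  | hole => exact ⟨const k, rfl, fun G' => .hole⟩
  | add_left q _ ih =>
    obtain ⟨r, rfl, hr⟩ := ih
    exact ⟨add r q, rfl, fun G' => (hr G').add_left q⟩
  | add_right p _ ih =>
    obtain ⟨r, rfl, hr⟩ := ih
    exact ⟨add p r, rfl, fun G' => (hr G').add_right p⟩
  | act x _ ih =>
    obtain ⟨r, rfl, hr⟩ := ih
    exact ⟨.act x r, rfl, fun G' => (hr G').act x⟩

omit [Add H] [SMul V H] in
/-- Substitution of `q` for all holes of a polynomial. -/
def subst (q : ForestPoly V H) : ForestPoly V H → ForestPoly V H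
  | hole => q
  | const h => const h
  | add p p' => add (subst q p) (subst q p')
  | act x p => act x (subst q p)

theorem vals_subst (p q : ForestPoly V H) (G : Set H) :
    (subst q p).vals G = p.vals (q.vals G) := by
  induction p with
  | hole => rfl
  | const _ => rfl
  | add p p' ih ih' => simp only [subst, vals, ih, ih']
  | act x p ih => simp only [subst, vals, ih]

/-- A hole of the composition lies in one copy of `q`, sitting at one hole of `p`; the other copies
range freely over the values of `q`. -/
theorem Fixed.of_subst {S G A : Set H} {p q : ForestPoly V H} (h : (subst q p).Fixed S G A) :
    ∃ B, q.Fixed S G B ∧ p.Fixed B (q.vals G) A := by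
  induction p generalizing A with
  | hole => exact ⟨A, h, .hole⟩
  | const _ => cases h
  | add p p' ih ih' =>
    cases h with
    | add_left _ h =>
      obtain ⟨B, hB, hA⟩ := ih h
      rw [vals_subst]
      exact ⟨B, hB, hA.add_left p'⟩
    | add_right _ h =>
      obtain ⟨B, hB, hA⟩ := ih' h
      rw [vals_subst]
      exact ⟨B, hB, hA.add_right p⟩
  | act x p ih =>
    cases h with
    | act _ h =>
      obtain ⟨B, hB, hA⟩ := ih h
      exact ⟨B, hB, hA.act x⟩

omit [Add H] [SMul V H] in
/-- The composition of a list of polynomials. -/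
def chain (L : List (ForestPoly V H)) : ForestPoly V H :=
  L.foldr (fun p q => subst q p) hole

/-- The values of the composition of a list of polynomials, when only those intermediate values
are admitted that belong to `K`. -/
def chainVals (K : Set H) (L : List (ForestPoly V H)) (G : Set H) : Set H :=
  L.foldr (fun p B => p.vals B ∩ K) G

theorem chainVals_append (K : Set H) (L L' : List (ForestPoly V H)) (G : Set H) :
    chainVals K (L ++ L') G = chainVals K L (chainVals K L' G) :=
  List.foldr_append

theorem chainVals_mono (K : Set H) (L : List (ForestPoly V H)) {G G' : Set H} (h : G ⊆ G') :
    chainVals K L G ⊆ chainVals K L G' := by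
  induction L with
  | nil => exact h
  | cons p L ih => exact Set.inter_subset_inter_left _ (vals_mono ih p)

theorem chainVals_subset (K : Set H) (L : List (ForestPoly V H)) {G : Set H} (h : G ⊆ K) :
    chainVals K L G ⊆ K := by
  cases L with
  | nil => exact h
  | cons p L => exact Set.inter_subset_right

theorem chainVals_subset_vals (K : Set H) (L : List (ForestPoly V H)) (G : Set H) :
    chainVals K L G ⊆ (chain L).vals G := by
  induction L with
  | nil => exact subset_rfl
  | cons p L ih =>
    change _ ⊆ (subst (chain L) p).vals G
    rw [vals_subst]
    exact Set.inter_subset_left.trans (vals_mono ih p)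

/-- Horizontal confusion can be lifted along a map `φ` from a finite set `K`, to a composition of
`p` with polynomials obtained from `p` by replacing holes by constants. -/
theorem exists_confusion_of_lift [Finite H] {C : Type*} (p : ForestPoly V H) (φ : H → C)
    {G : Set C} (hG : G.Nontrivial) {K : Set H} (hK : G ⊆ φ '' K)
    (hvals : ∀ D ⊆ K, G ⊆ φ '' D → G ⊆ φ '' (p.vals D ∩ K))
    (hfix : ∀ D ⊆ K, G ⊆ φ '' D → ∀ k ∈ K, ∀ A, p.Fixed {k} D A → G ⊆ φ '' (A ∩ K)) :
    ∃ (q : ForestPoly V H) (D : Set H), q.Confusion D := by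
  let good : ForestPoly V H → Prop := fun q =>
    ∀ D ⊆ K, G ⊆ φ '' D → G ⊆ φ '' (q.vals D ∩ K)
  let lists : Set (List (ForestPoly V H)) := {L | ∀ q ∈ L, good q}
  have honto : ∀ L ∈ lists, G ⊆ φ '' chainVals K L K := by
    intro L
    induction L with
    | nil => exact fun _ => hK
    | cons q L ih =>
      intro hL
      exact hL q (by simp) _ (chainVals_subset K L subset_rfl)
        (ih fun r hr => hL r (List.mem_cons_of_mem q hr))
  have hne : lists.Nonempty := ⟨[], by simp [lists]⟩
  -- Among the sets obtained from `K` by chains of good polynomials, all of which still map onto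
  -- `G`, a smallest one is taken as the lift of `G`.
  let L := Function.argminOn (fun L => (chainVals K L K).ncard) lists hne
  have hL : L ∈ lists := Function.argminOn_mem _ _ _
  let D := chainVals K L K
  have hDK : D ⊆ K := chainVals_subset K L subset_rfl
  -- The longer chain `L`, `q`, `L` produces a subset of `D`, which by minimality is all of `D`.
  have hmin : ∀ q, good q → D ⊆ chainVals K L (q.vals D ∩ K) := by
    intro q hq
    have hmem : L ++ ([q] ++ L) ∈ lists := by
      intro r hr
      simp only [List.mem_append, List.mem_singleton] at hr
      rcases hr with hr | rfl | hr
      exacts [hL r hr, hq, hL r hr]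
    have hle := Function.argminOn_le (fun L => (chainVals K L K).ncard) lists hmem
    have hE : chainVals K (L ++ ([q] ++ L)) K = chainVals K L (q.vals D ∩ K) := by
      rw [chainVals_append, chainVals_append]; rfl
    rw [hE] at hle
    exact (Set.eq_of_subset_of_ncard_le (chainVals_mono K L Set.inter_subset_right) hle
      (Set.toFinite _)).ge
  refine ⟨subst p (chain L), D, ?_, ?_, ?_⟩
  · obtain ⟨a, ha, b, hb, hab⟩ := hG
    obtain ⟨x, hx, rfl⟩ := honto L hL ha
    obtain ⟨y, hy, rfl⟩ := honto L hL hb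
    exact ⟨x, hx, y, hy, fun h => hab (congrArg φ h)⟩
  · rw [vals_subst]
    exact (hmin p hvals).trans ((chainVals_subset_vals K L _).trans
      (vals_mono Set.inter_subset_left _))
  · intro g hg A hA
    obtain ⟨B, hB, hBA⟩ := hA.of_subst
    obtain ⟨q, rfl, hq⟩ := hB.exists_plug
    have hsub := hB.subset_vals (Set.singleton_subset_iff.2 hg)
    -- The copy of `p` with the fixed hole becomes the good polynomial `q`. Restricting every copy
    -- to values of `q` only shrinks the set of results, which still contains `D`.
    have hgood : good q := fun E hE hGE => hfix E hE hGE g (hDK hg) _ (hq E)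
    exact (hmin q hgood).trans ((chainVals_subset_vals K L _).trans
      (hBA.vals_subset Set.inter_subset_left (Set.inter_subset_left.trans hsub)))

end

/-! ### Horizontal confusion in wreath products -/

section

variable {X Y : ForestAlgebra.{u}}

/-- The first component of a polynomial over a wreath product. -/
def wreathFst : ForestPoly (ForestAlgebra.WreathV X Y) (X.H × Y.H) → ForestPoly X.V X.H
  | hole => hole
  | const h => const h.1
  | add p q => add (wreathFst p) (wreathFst q)
  | act x p => act x.fst (wreathFst p)

/-- The first component of the value of a polynomial over a wreath product, when all holes have
the first component `h`. -/
def wreathEval (h : X.H) : ForestPoly (ForestAlgebra.WreathV X Y) (X.H × Y.H) → X.H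
  | hole => h
  | const c => c.1
  | add p q => wreathEval h p + wreathEval h q
  | act x p => x.fst • wreathEval h p

/-- The second component of a polynomial over a wreath product, when all holes have the first
component `h`. -/
def wreathSnd (h : X.H) :
    ForestPoly (ForestAlgebra.WreathV X Y) (X.H × Y.H) → ForestPoly Y.V Y.H
  | hole => hole
  | const c => const c.2
  | add p q => add (wreathSnd h p) (wreathSnd h q)
  | act x p => act (x.snd (wreathEval h p)) (wreathSnd h p)

variable {G : Set (X.H × Y.H)} {p : ForestPoly (ForestAlgebra.WreathV X Y) (X.H × Y.H)}

theorem fst_mem_vals (p : ForestPoly (ForestAlgebra.WreathV X Y) (X.H × Y.H)) :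
    ∀ a ∈ p.vals G, a.1 ∈ (wreathFst p).vals (Prod.fst '' G) := by
  induction p with
  | hole => exact fun a ha => ⟨a, ha, rfl⟩
  | const c => rintro a rfl; rfl
  | add p q ihp ihq =>
    rintro _ ⟨a, ha, b, hb, rfl⟩
    exact ⟨a.1, ihp a ha, b.1, ihq b hb, rfl⟩
  | act x p ih =>
    rintro _ ⟨a, ha, rfl⟩
    exact ⟨a.1, ih a ha, rfl⟩

/-- Confusion asks for large value sets, so it suffices that the values upstairs project into those
downstairs. -/
theorem fixed_of_wreathFst {S : Set (X.H × Y.H)} {B : Set X.H}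
    (h : (wreathFst p).Fixed (Prod.fst '' S) (Prod.fst '' G) B) :
    ∃ A, p.Fixed S G A ∧ ∀ a ∈ A, a.1 ∈ B := by
  induction p generalizing B with
  | hole => cases h; exact ⟨S, .hole, fun a ha => ⟨a, ha, rfl⟩⟩
  | const c => cases h
  | add p q ihp ihq =>
    cases h with
    | add_left _ h =>
      obtain ⟨A, hA, hAB⟩ := ihp h
      refine ⟨_, hA.add_left q, ?_⟩
      rintro _ ⟨a, ha, b, hb, rfl⟩
      exact ⟨a.1, hAB a ha, b.1, fst_mem_vals q b hb, rfl⟩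
    | add_right _ h =>
      obtain ⟨A, hA, hAB⟩ := ihq h
      refine ⟨_, hA.add_right p, ?_⟩
      rintro _ ⟨a, ha, b, hb, rfl⟩
      exact ⟨a.1, fst_mem_vals p a ha, b.1, hAB b hb, rfl⟩
  | act x p ih =>
    cases h with
    | act _ h =>
      obtain ⟨A, hA, hAB⟩ := ih h
      refine ⟨_, hA.act x, ?_⟩
      rintro _ ⟨a, ha, rfl⟩
      exact ⟨a.1, hAB a ha, rfl⟩

theorem snd_mem_vals {h : X.H} (hG : ∀ g ∈ G, g.1 = h)
    (p : ForestPoly (ForestAlgebra.WreathV X Y) (X.H × Y.H)) :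
    ∀ a ∈ p.vals G, a.1 = wreathEval h p ∧ a.2 ∈ (wreathSnd h p).vals (Prod.snd '' G) := by
  induction p with
  | hole => exact fun a ha => ⟨hG a ha, a, ha, rfl⟩
  | const c => rintro a rfl; exact ⟨rfl, rfl⟩
  | add p q ihp ihq =>
    rintro _ ⟨a, ha, b, hb, rfl⟩
    obtain ⟨e, ha⟩ := ihp a ha
    obtain ⟨e', hb⟩ := ihq b hb
    exact ⟨congrArg₂ (· + ·) e e', a.2, ha, b.2, hb, rfl⟩
  | act x p ih =>
    rintro _ ⟨a, ha, rfl⟩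
    obtain ⟨e, ha⟩ := ih a ha
    exact ⟨congrArg (x.fst • ·) e, a.2, ha, congrArg (fun z => x.snd z • a.2) e.symm⟩

theorem fixed_of_wreathSnd {h : X.H} (hG : ∀ g ∈ G, g.1 = h) {S : Set (X.H × Y.H)} (hS : S ⊆ G)
    {B : Set Y.H} (hB : (wreathSnd h p).Fixed (Prod.snd '' S) (Prod.snd '' G) B) :
    ∃ A, p.Fixed S G A ∧ ∀ a ∈ A, a.2 ∈ B := by
  induction p generalizing B with
  | hole => cases hB; exact ⟨S, .hole, fun a ha => ⟨a, ha, rfl⟩⟩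
  | const c => cases hB
  | add p q ihp ihq =>
    cases hB with
    | add_left _ hB =>
      obtain ⟨A, hA, hAB⟩ := ihp hB
      refine ⟨_, hA.add_left q, ?_⟩
      rintro _ ⟨a, ha, b, hb, rfl⟩
      exact ⟨a.2, hAB a ha, b.2, (snd_mem_vals hG q b hb).2, rfl⟩
    | add_right _ hB =>
      obtain ⟨A, hA, hAB⟩ := ihq hB
      refine ⟨_, hA.add_right p, ?_⟩
      rintro _ ⟨a, ha, b, hb, rfl⟩
      exact ⟨a.2, (snd_mem_vals hG p a ha).2, b.2, hAB b hb, rfl⟩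
  | act x p ih =>
    cases hB with
    | act _ hB =>
      obtain ⟨A, hA, hAB⟩ := ih hB
      refine ⟨_, hA.act x, ?_⟩
      rintro _ ⟨a, ha, rfl⟩
      -- Since `S ⊆ G`, the fixed hole also has first component `h`, so the element of `Y.V` that
      -- acts here is the one chosen by `wreathSnd`.
      have e := (snd_mem_vals hG p a (hA.subset_vals hS ha)).1
      exact ⟨a.2, hAB a ha, congrArg (fun z => x.snd z • a.2) e.symm⟩

/-- A polynomial with horizontal confusion over a wreath product yields one over a factor. -/
theorem Confusion.of_wreath (hp : p.Confusion G) :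
    (∃ (q : ForestPoly X.V X.H) (D : Set X.H), q.Confusion D) ∨
      ∃ (q : ForestPoly Y.V Y.H) (D : Set Y.H), q.Confusion D := by
  obtain ⟨hG, hpG, hfix⟩ := hp
  by_cases h₁ : (Prod.fst '' G).Nontrivial
  · refine .inl ⟨wreathFst p, Prod.fst '' G, h₁, ?_, ?_⟩
    · rintro _ ⟨a, ha, rfl⟩
      exact fst_mem_vals p a (hpG ha)
    · rintro _ ⟨g, hg, rfl⟩ B hB
      rw [← Set.image_singleton] at hB
      obtain ⟨A, hA, hAB⟩ := fixed_of_wreathFst hB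
      rintro _ ⟨a, ha, rfl⟩
      exact hAB a (hfix g hg A hA ha)
  · obtain ⟨a, ha, b, hb, hab⟩ := hG
    have hG₁ : ∀ g ∈ G, g.1 = a.1 := fun g hg => by
      by_contra hne
      exact h₁ ⟨_, ⟨g, hg, rfl⟩, _, ⟨a, ha, rfl⟩, hne⟩
    refine .inr ⟨wreathSnd a.1 p, Prod.snd '' G, ?_, ?_, ?_⟩
    · exact ⟨_, ⟨a, ha, rfl⟩, _, ⟨b, hb, rfl⟩, fun e => hab (Prod.ext (hG₁ b hb).symm e)⟩
    · rintro _ ⟨g, hg, rfl⟩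
      exact (snd_mem_vals hG₁ p g (hpG hg)).2
    · rintro _ ⟨g, hg, rfl⟩ B hB
      rw [← Set.image_singleton] at hB
      obtain ⟨A, hA, hAB⟩ := fixed_of_wreathSnd hG₁ (Set.singleton_subset_iff.2 hg) hB
      rintro _ ⟨c, hc, rfl⟩
      exact hAB c (hfix g hg A hA hc)

end

end ForestPoly

namespace ForestAlgebra

theorem IsPathAlgebra.not_confusion {X : ForestAlgebra.{u}} (hX : X.IsPathAlgebra)
    (p : ForestPoly X.V X.H) (G : Set X.H) : ¬ p.Confusion G := by
  let : AddCommMonoid X.H := { X.addMonoidH with add_comm := hX.add_comm }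
  have := hX.finite_V
  choose t ht using X.exists_smul_eq_add_left
  obtain ⟨m, -, hm⟩ := hX.aperiodic_H
  exact ForestPoly.not_confusion_of_pathLaws (t := t)
    ⟨ht, ⟨m, hm⟩, hX.smul_add_smul, hX.idem_smul_add⟩ p G

theorem IsIteratedWreath.not_confusion {X : ForestAlgebra.{u}}
    (hX : IsIteratedWreath IsPathAlgebra X) :
    ∀ (p : ForestPoly X.V X.H) (G : Set X.H), ¬ p.Confusion G := by
  induction hX with
  | base h => exact h.not_confusion
  | @wreath X Y _ _ ih₁ ih₂ =>
    intro p G hp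
    rcases ForestPoly.Confusion.of_wreath (X := X) (Y := Y) hp with ⟨q, D, h⟩ | ⟨q, D, h⟩
    exacts [ih₁ q D h, ih₂ q D h]

end ForestAlgebra

/-! ### Evaluation of multicontexts, and divisors -/

namespace Multicontext

variable {A : Type v}

/-- The value of a multicontext at a valuation, where a node labelled `a` acts by `w a`. -/
def evalWith {V H : Type*} [AddMonoid H] [SMul V H] (w : A → V) :
    (p : Multicontext A) → (p.Holes → H) → H
  | nil, _ => 0
  | hole q, μ => μ none + q.evalWith w fun x => μ (some x)
  | node a p q, μ =>
      w a • p.evalWith w (fun x => μ (Sum.inl x)) + q.evalWith w fun x => μ (Sum.inr x)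

/-- The polynomial of a multicontext. -/
def toPoly {V H : Type*} [Zero H] (w : A → V) : Multicontext A → ForestPoly V H
  | nil => .const 0
  | hole q => .add .hole (q.toPoly w)
  | node a p q => .add (.act (w a) (p.toPoly w)) (q.toPoly w)

section

variable {V H : Type*} [AddMonoid H] [SMul V H] (w : A → V)

theorem evalWith_mem_vals {G : Set H} :
    ∀ (p : Multicontext A) (μ : p.Holes → H), (∀ x, μ x ∈ G) →
      p.evalWith w μ ∈ (p.toPoly w : ForestPoly V H).vals G
  | nil, _, _ => rfl
  | hole q, _μ, h => ⟨_, h none, _, evalWith_mem_vals q _ fun x => h (some x), rfl⟩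
  | node _ p q, _μ, h => ⟨_, ⟨_, evalWith_mem_vals p _ fun x => h (Sum.inl x), rfl⟩, _,
      evalWith_mem_vals q _ fun x => h (Sum.inr x), rfl⟩

/-- A derivation of `Fixed` traces a path to one hole of the polynomial, and the holes of the
polynomial are those of the multicontext. -/
theorem exists_hole_of_fixed {S G : Set H} :
    ∀ (p : Multicontext A) {B : Set H}, (p.toPoly w : ForestPoly V H).Fixed S G B →
      ∃ x : p.Holes, ∀ μ : p.Holes → H, μ x ∈ S → (∀ y, y ≠ x → μ y ∈ G) → p.evalWith w μ ∈ B
  | nil, _, h => by cases h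
  | hole q, _, h => by
    cases h with
    | add_left _ h =>
      cases h
      exact ⟨none, fun μ hx hy => ⟨_, hx, _,
        evalWith_mem_vals w q _ fun x => hy (some x) (Option.some_ne_none x), rfl⟩⟩
    | add_right _ h =>
      obtain ⟨x, hx⟩ := exists_hole_of_fixed q h
      exact ⟨some x, fun μ hμ hy => ⟨_, hy none (Option.some_ne_none x).symm, _,
        hx _ hμ fun y hyx => hy (some y) fun e => hyx (Option.some_injective _ e), rfl⟩⟩
  | node a p q, _, h => by
    cases h with
    | add_left _ h =>
      cases h with
      | act _ h =>
        obtain ⟨x, hx⟩ := exists_hole_of_fixed p h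
        exact ⟨Sum.inl x, fun μ hμ hy => ⟨_, ⟨_, hx _ hμ fun y hyx =>
          hy (Sum.inl y) fun e => hyx (Sum.inl_injective e), rfl⟩, _,
          evalWith_mem_vals w q _ fun y => hy (Sum.inr y) Sum.inr_ne_inl, rfl⟩⟩
    | add_right _ h =>
      obtain ⟨x, hx⟩ := exists_hole_of_fixed q h
      exact ⟨Sum.inr x, fun μ hμ hy => ⟨_, ⟨_, evalWith_mem_vals w p _ fun y =>
        hy (Sum.inl y) Sum.inl_ne_inr, rfl⟩, _, hx _ hμ fun y hyx =>
          hy (Sum.inr y) fun e => hyx (Sum.inr_injective e), rfl⟩⟩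

/-- The value of a multicontext all of whose roots are the same. -/
theorem evalWith_eq_nsmul (s : Multicontext A) (h : H) :
    ∀ p : Multicontext A, (∀ t ∈ p.subtreesAt 0, t = s) →
      (p.evalWith w fun _ => h) = (p.subtreesAt 0).length • s.evalWith w fun _ => h
  | nil, _ => by simp [evalWith, subtreesAt]
  | hole q, hs => by
    obtain rfl : hole nil = s := hs _ (by simp [subtreesAt])
    have := evalWith_eq_nsmul _ h q fun t ht => hs t (by simp [subtreesAt, ht])
    simp only [evalWith, subtreesAt, List.length_cons, succ_nsmul', add_zero] at this ⊢
    rw [this]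
  | node a p q, hs => by
    obtain rfl : node a p nil = s := hs _ (by simp [subtreesAt])
    have := evalWith_eq_nsmul _ h q fun t ht => hs t (by simp [subtreesAt, ht])
    simp only [evalWith, subtreesAt, List.length_cons, succ_nsmul', add_zero] at this ⊢
    rw [this]

end

theorem polyFun_evalWith {Y : ForestAlgebra.{u}} (w : A → Y.V) :
    ∀ p : Multicontext A, Y.PolyFun fun h => p.evalWith w fun _ => h
  | nil => .zero
  | hole q => .add .id (polyFun_evalWith w q)
  | node a p q => .add (.smul (w a) (polyFun_evalWith w p)) (polyFun_evalWith w q)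

/-- All roots carry the same subtree, so the value is a multiple of the value of the first tree, and
the forest below its root is again uniform. -/
theorem uniformFun_evalWith {Y : ForestAlgebra.{u}} (w : A → Y.V) :
    ∀ p : Multicontext A, p.IsUniform → Y.UniformFun fun h => p.evalWith w fun _ => h
  | nil, _ => by
    have := ForestAlgebra.UniformFun.nsmul_smul 0 1 (.id (X := Y))
    simpa only [zero_nsmul, evalWith] using this
  | hole q, hp => by
    have h₁ : hole nil ∈ (hole q).subtreesAt 0 := by simp [subtreesAt]
    have := ForestAlgebra.UniformFun.nsmul_smul ((hole q).subtreesAt 0).length 1 (.id (X := Y))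
    convert this using 2 with h
    rw [evalWith_eq_nsmul w (hole nil) h _ fun t ht => hp.2 0 t ht _ h₁]
    simp [evalWith]
  | node a r q, hp => by
    have h₁ : node a r nil ∈ (node a r q).subtreesAt 0 := by simp [subtreesAt]
    have hr : r.IsUniform := by
      have hsub : ∀ n, ∀ t ∈ r.subtreesAt n, t ∈ (node a r q).subtreesAt (n + 1) :=
        fun n t ht => by simp [subtreesAt, ht]
      exact ⟨fun n b hb => hp.1 (n + 1) b (hsub n _ hb),
        fun n s hs t ht => hp.2 (n + 1) s (hsub n s hs) t (hsub n t ht)⟩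
    have := ForestAlgebra.UniformFun.nsmul_smul ((node a r q).subtreesAt 0).length (w a)
      (uniformFun_evalWith w r hr)
    convert this using 2 with h
    rw [evalWith_eq_nsmul w (node a r nil) h _ fun t ht => hp.2 0 t ht _ h₁]
    simp [evalWith]

/-- Evaluation in a divisor can be lifted to the algebra that it divides. -/
theorem exists_lift_of_divides {X : ForestAlgebra.{u}} {Y : ForestAlgebra.{u₂}}
    (h : X.Divides Y) (α : (freeForestAlgebra A).Hom X) :
    ∃ (w : A → Y.V) (K : AddSubmonoid Y.H) (φ : K → X.H), Function.Surjective φ ∧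
      ∀ (p : Multicontext A) (μ : p.Holes → K),
        ∃ hK : p.evalWith w (fun x => (μ x : Y.H)) ∈ K,
          φ ⟨_, hK⟩ = p.eval α fun x => φ (μ x) := by
  obtain ⟨K, W, stable, φ, ψ, -, -, hφ, hψ, hmap⟩ := h
  -- Only the letters have to be lifted, since evaluation uses the vertical monoid through them
  -- alone.
  choose w hw using fun a : A => hψ (α.onV (Context.letter a))
  refine ⟨fun a => w a, K, φ, hφ, fun p => ?_⟩
  induction p with
  | nil => exact fun μ => ⟨K.zero_mem, φ.map_zero⟩
  | hole q ih =>
    intro μ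
    obtain ⟨hq, e⟩ := ih fun x => μ (some x)
    refine ⟨K.add_mem (μ none).2 hq, ?_⟩
    have := φ.map_add (μ none) ⟨_, hq⟩
    rw [e] at this
    exact this
  | node a p q ihp ihq =>
    intro μ
    obtain ⟨hp, e⟩ := ihp fun x => μ (Sum.inl x)
    obtain ⟨hq, e'⟩ := ihq fun x => μ (Sum.inr x)
    refine ⟨K.add_mem (stable _ (w a).2 _ hp) hq, ?_⟩
    have := φ.map_add ⟨_, stable _ (w a).2 _ hp⟩ ⟨_, hq⟩
    rw [hmap (w a) ⟨_, hp⟩, e, e', hw] at this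
    exact this

/-- There is no vertical confusion if the maps given by `p` in an algebra of which `X` is a divisor
have only fixed points as periodic points. -/
theorem not_verticalConfusion {X : ForestAlgebra.{u}} {Y : ForestAlgebra.{u₂}} [Finite Y.H]
    (h : X.Divides Y) (α : (freeForestAlgebra A).Hom X) (p : Multicontext A)
    (hp : ∀ w : A → Y.V, PeriodicPointsFixed fun h : Y.H => p.evalWith w fun _ => h)
    {k : ℕ} (g : Fin k → X.H) : ¬ p.VerticalConfusion α g := by
  rintro ⟨hk, hg, hcycle⟩
  obtain ⟨w, K, φ, hφ, hlift⟩ := exists_lift_of_divides h α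
  choose hK e using hlift p
  let F : K → K := fun x => ⟨_, hK fun _ => x⟩
  have hF : PeriodicPointsFixed F := by
    intro d hd x hx
    have it : ∀ n, ((F^[n] x : K) : Y.H) = (fun h => p.evalWith w fun _ => h)^[n] (x : Y.H) := by
      intro n
      induction n with
      | zero => rfl
      | succ n ih => rw [Function.iterate_succ_apply', Function.iterate_succ_apply', ← ih]
    exact Subtype.ext (hp w d hd x (by rw [← it, hx]))
  exact hF.no_cycle_of_lift (f := fun h => p.eval α fun _ => h) hφ (fun x => e fun _ => x) hk hg
    hcycle

open Classical in
/-- Horizontal confusion can be lifted from a divisor. -/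
theorem HorizontalConfusion.exists_lift {X : ForestAlgebra.{u}} {Y : ForestAlgebra.{u₂}}
    [Finite Y.H] (h : X.Divides Y) {α : (freeForestAlgebra A).Hom X} {p : Multicontext A}
    [Nonempty p.Holes] {G : Set X.H} (hp : p.HorizontalConfusion α G) :
    ∃ (q : ForestPoly Y.V Y.H) (D : Set Y.H), q.Confusion D := by
  obtain ⟨hG, hconf⟩ := hp
  obtain ⟨w, K, φ, hφ, hlift⟩ := exists_lift_of_divides h α
  -- The default value outside `K` plays no role, as `K'` admits only elements of `K`.
  let φ' : Y.H → X.H := fun y => if hy : y ∈ K then φ ⟨y, hy⟩ else 0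
  have hφ' : ∀ y : K, φ' y = φ y := fun y => dif_pos y.2
  let K' : Set Y.H := {y | y ∈ K ∧ φ' y ∈ G}
  have key : ∀ D ⊆ K', G ⊆ φ' '' D → ∀ k ∈ K', ∀ x : p.Holes, ∀ c ∈ G,
      ∃ μ : p.Holes → Y.H, μ x = k ∧ (∀ y, y ≠ x → μ y ∈ D) ∧ p.evalWith w μ ∈ K' ∧
        φ' (p.evalWith w μ) = c := by
    intro D hD hGD k hk x c hc
    obtain ⟨ν, hνx, hν, rfl⟩ := hconf _ hk.2 x hc
    -- The valuation is lifted hole by hole: to the prescribed `k` at `x`, and to some preimage in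
    -- `D` elsewhere.
    have : ∀ y : p.Holes, ∃ z : K, φ z = ν y ∧ (y = x → (z : Y.H) = k) ∧ (y ≠ x → (z : Y.H) ∈ D) := by
      intro y
      by_cases hy : y = x
      · subst hy
        exact ⟨⟨k, hk.1⟩, by rw [hνx, ← hφ'], fun _ => rfl, fun h => absurd rfl h⟩
      · obtain ⟨z, hz, e⟩ := hGD (hν y hy)
        exact ⟨⟨z, (hD hz).1⟩, by rw [← hφ', e], fun h => absurd h hy, fun _ => hz⟩
    choose μ hμν hμx hμ using this
    obtain ⟨hK, e⟩ := hlift p μ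
    have e' : φ' (p.evalWith w fun y => (μ y : Y.H)) = p.eval α ν := by
      rw [hφ' ⟨_, hK⟩, e]
      exact congrArg _ (funext hμν)
    exact ⟨fun y => μ y, hμx x rfl, hμ, ⟨hK, by rw [e']; exact hc⟩, e'⟩
  refine ForestPoly.exists_confusion_of_lift (p.toPoly w) φ' hG (K := K') ?_ ?_ ?_
  · intro c hc
    obtain ⟨z, rfl⟩ := hφ c
    exact ⟨z, ⟨z.2, by rw [hφ']; exact hc⟩, hφ' z⟩
  · intro D hD hGD c hc
    obtain ⟨k, hk, -⟩ := hGD hc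
    -- Fixing some hole at a value `k` from `D` itself yields a valuation with all values in `D`;
    -- this is where a hole is needed.
    obtain ⟨x⟩ := ‹Nonempty p.Holes›
    obtain ⟨μ, hx, hμ, hK, e⟩ := key D hD hGD k (hD hk) x c hc
    refine ⟨_, ⟨evalWith_mem_vals w p μ fun y => ?_, hK⟩, e⟩
    by_cases hy : y = x
    · rw [hy, hx]; exact hk
    · exact hμ y hy
  · intro D hD hGD k hk B hB c hc
    obtain ⟨x, hx⟩ := exists_hole_of_fixed w p hB
    obtain ⟨μ, hμx, hμ, hK, e⟩ := key D hD hGD k hk x c hc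
    exact ⟨_, ⟨hx μ hμx hμ, hK⟩, e⟩

end Multicontext

/-- The Confusion Theorem. In the last part, the multicontext is required to have a hole. -/
theorem mainTheorem5 (X : ForestAlgebra.{u}) :
    (X.IsCTLAlgebra →
      ∀ (A : Type v) [Finite A] (α : (freeForestAlgebra A).Hom X) (p : Multicontext A)
        (k : ℕ) (g : Fin k → X.H), ¬ p.VerticalConfusion α g) ∧
    (X.IsFOAlgebra →
      ∀ (A : Type v) [Finite A] (α : (freeForestAlgebra A).Hom X) (p : Multicontext A),
        p.IsUniform → ∀ (k : ℕ) (g : Fin k → X.H), ¬ p.VerticalConfusion α g) ∧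
    (X.IsGradedPDLAlgebra →
      ∀ (A : Type v) [Finite A] (α : (freeForestAlgebra A).Hom X) (p : Multicontext A),
        Nonempty p.Holes → ∀ G : Set X.H, ¬ p.HorizontalConfusion α G) := by
  refine ⟨?_, ?_, ?_⟩
  · rintro ⟨Y, hY, h⟩ A _ α p k g
    have : Finite Y.H := hY.finite fun Z hZ => by rw [hZ]; exact inferInstanceAs (Finite ForestAlgebra.U₂H)
    refine p.not_verticalConfusion h α (fun w => ?_) g
    refine hY.polyFun_fixed (fun Z hZ => ?_) _ (p.polyFun_evalWith w)
    subst hZ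
    exact ForestAlgebra.U₂_polyFun_fixed
  · rintro ⟨Y, hY, h⟩ A _ α p hp k g
    have : Finite Y.H := hY.finite fun Z hZ => hZ.finite_H
    refine p.not_verticalConfusion h α (fun w => ?_) g
    exact hY.uniformFun_fixed (fun Z hZ => hZ.uniformFun_fixed) _ (p.uniformFun_evalWith w hp)
  · rintro ⟨Y, hY, h⟩ A _ α p hp G hG
    have : Finite Y.H := hY.finite fun Z hZ => hZ.finite_H
    obtain ⟨q, D, hq⟩ := hG.exists_lift h
    exact hY.not_confusion q D hq
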